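/- **Setting.** Let $p$ be a prime, let $R$ be a finite $p$-group and let $T$ be a free $\mathbb{Z}_p$-module of finite rank $d \ge 0$ on which $R$ acts $\mathbb{Z}_p$-linearly and uniserially: with $T_0 := T$ and $T_{i+1} := [R,T_i] = \langle gv - v \mid v \in T_i,\ g \in R\rangle$, we have $[T_i : T_{i+1}] = p$ for every $i$ with $T_i \ne 0$. Then $T_{n+d} = pT_n$ for all $n$, and the $R$-module isomorphism $T_n \to T_{n+d}$, $t \mapsto pt$, induces an isomorphism $\mu = \mu(n) : H^3(R,T_n) \to H^3(R,T_{n+d})$. For an $R$-module $V$ let $\mathrm{Comp}(R,V)$ be the group of all pairs $(\beta,\epsilon) \in \operatorname{Aut} R \times \operatorname{Aut} V$ with $\epsilon(gv) = \beta(g)\,\epsilon(v)$ for all $g \in R$ and $v \in V$. It acts on $H^2(R,V)$ by $(\gamma^{(\beta,\epsilon)})(g,h) = \epsilon\bigl(\gamma(\beta^{-1}(g),\beta^{-1}(h))\bigr)$ on $2$-cocycles $\gamma$. A *canonical isomorphism* at level $n$ is a group isomorphism $\Phi : H^2(R,T) \oplus H^3(R,T_n) \to H^2(R,T/T_n)$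 such that 1. $\Phi(\alpha,0)$ is the image of $\alpha$ under the map induced by $T \to T/T_n$, for every $\alpha \in H^2(R,T)$; 2. the connecting homomorphism $H^2(R,T/T_n) \to H^3(R,T_n)$ of the sequence $0 \to T_n \to T \to T/T_n \to 0$ maps $\Phi(\alpha,\beta)$ to $\beta$, for all $\alpha$ and $\beta$; 3. for every $\beta \in H^3(R,T_n)$ the class $\Phi(0,\beta)$ is represented by a $2$-cocycle with values in $\{t \in T \mid f t \in T_n\}/T_n$, where $f$ is the exponent of $H^3(R,T_n)$. **Theorem.** There is an integer $N$ (depending on $R$ and $T$) such that for every $n \ge N$ there is exactly one canonical isomorphism $\Phi_n : H^2(R,T) \oplus H^3(R,T_n) \to H^2(R,T/T_n)$, and the group isomorphism $$(\mathrm{id} \oplus \mu) := \Phi_{n+d} \circ (\mathrm{id} \times \mu) \circ \Phi_n^{-1} : H^2(R,T/T_n) \to H^2(R,T/T_{n+d})$$ induces a bijection from the set of $\mathrm{Comp}(R,T/T_n)$-orbits of $H^2(R,T/T_n)$ onto the set of $\mathrm{Comp}(R,T/T_{n+d})$-orbits of $H^2(R,T/T_{n+d})$: the orbit of $\tau$ is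 mapped to the orbit of $(\mathrm{id} \oplus \mu)(\tau)$. -/

import Mathlib

open CategoryTheory

namespace UniserialCohomology

section Series

variable {k R : Type} [CommRing k] [Group R]

/-- The lower `R`-central series of an `R`-module `A`, as a sequence of additive subgroups:
`A_0 = A` and `A_{i+1} = [R, A_i]` is generated by all `g v - v` with `v ∈ A_i` and `g ∈ R`. -/
def lowerSeries (A : Rep.{0} k R) : ℕ → Submodule k A
  | 0 => ⊤
  | i + 1 => Submodule.span k {x | ∃ v ∈ lowerSeries A i, ∃ g : R, x = A.ρ g v - v}

/-- `R` acts uniserially (with respect to `p`) on `A`: `[A_i : A_{i+1}] = p` whenever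
`A_i ≠ 0`. -/
def IsUniserial (p : ℕ) (A : Rep.{0} k R) : Prop :=
  ∀ i, lowerSeries A i ≠ ⊥ →
    (lowerSeries A (i + 1)).toAddSubgroup.relIndex (lowerSeries A i).toAddSubgroup = p

lemma lowerSeries_le_comap (A : Rep.{0} k R) (n : ℕ) (g : R) :
    lowerSeries A n ≤ (lowerSeries A n).comap (A.ρ g) := by
  induction n generalizing g with
  | zero => exact fun _ _ => trivial
  | succ n ih =>
    refine Submodule.span_le.2 ?_
    rintro _ ⟨v, hv, h, rfl⟩
    refine Submodule.subset_span ⟨A.ρ g v, ih g hv, g * h * g⁻¹, ?_⟩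
    rw [map_sub, ← Module.End.mul_apply, ← Module.End.mul_apply, ← map_mul, ← map_mul]
    simp

lemma lowerSeries_succ_le (A : Rep.{0} k R) (n : ℕ) :
    lowerSeries A (n + 1) ≤ lowerSeries A n := by
  refine Submodule.span_le.2 ?_
  rintro _ ⟨v, hv, h, rfl⟩
  exact sub_mem (lowerSeries_le_comap A n h hv) hv

/-- The `R`-module `A_n`, the `n`-th term of the lower `R`-central series. -/
noncomputable abbrev subRep (A : Rep.{0} k R) (n : ℕ) : Rep.{0} k R :=
  A.subrepresentation (lowerSeries A n) (lowerSeries_le_comap A n)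

/-- The `R`-module `A / A_n`. -/
noncomputable abbrev quotRep (A : Rep.{0} k R) (n : ℕ) : Rep.{0} k R :=
  A.quotient (lowerSeries A n) (lowerSeries_le_comap A n)

/-- The sequence `0 → A_n → A → A / A_n → 0` of `R`-modules. -/
noncomputable def seriesSeq (A : Rep.{0} k R) (n : ℕ) : ShortComplex (Rep.{0} k R) :=
  ShortComplex.mk (X₁ := subRep A n) (X₂ := A) (X₃ := quotRep A n)
    (A.subtype (lowerSeries A n) (lowerSeries_le_comap A n))
    (A.mkQ (lowerSeries A n) (lowerSeries_le_comap A n))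
    (by
      refine Rep.hom_ext (Representation.IntertwiningMap.ext (LinearMap.ext fun x => ?_))
      exact (Submodule.Quotient.mk_eq_zero _).2 x.2)

lemma seriesSeq_shortExact (A : Rep.{0} k R) (n : ℕ) : (seriesSeq A n).ShortExact where
  exact := by
    refine (forget₂ _ (ModuleCat k)).reflects_exact_of_faithful _ ?_
    rw [ShortComplex.moduleCat_exact_iff_range_eq_ker]
    change LinearMap.range (lowerSeries A n).subtype = LinearMap.ker (lowerSeries A n).mkQ
    rw [Submodule.range_subtype, Submodule.ker_mkQ]
  mono_f := (Rep.mono_iff_injective _).2 (lowerSeries A n).injective_subtype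
  epi_g := (Rep.epi_iff_surjective _).2 (lowerSeries A n).mkQ_surjective

/-- The map `H²(R, A) → H²(R, A / A_n)` induced by the projection `A → A / A_n`. -/
noncomputable def reduction (A : Rep.{0} k R) (n : ℕ) :
    groupCohomology A 2 →+ groupCohomology (quotRep A n) 2 :=
  (groupCohomology.map (MonoidHom.id R) (seriesSeq A n).g 2).hom.toAddMonoidHom

/-- The connecting homomorphism `H²(R, A / A_n) → H³(R, A_n)` of the long exact cohomology
sequence of `0 → A_n → A → A / A_n → 0`. -/
noncomputable def connecting (A : Rep.{0} k R) (n : ℕ) :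
    groupCohomology (quotRep A n) 2 →+ groupCohomology (subRep A n) 3 :=
  (groupCohomology.δ (seriesSeq_shortExact A n) 2 3 rfl).hom.toAddMonoidHom

/-- `Φ : H²(R, A) ⊕ H³(R, A_n) ≃ H²(R, A / A_n)` is the canonical isomorphism: it splits
`0 → H²(R, A) → H²(R, A / A_n) → H³(R, A_n) → 0`, and the classes in the image of the second
summand are represented by cocycles with values in `f⁻¹ A_n / A_n`, where `f` is the exponent
of `H³(R, A_n)`. -/
structure IsCanonical (A : Rep.{0} k R) (n : ℕ)
    (Φ : groupCohomology A 2 × groupCohomology (subRep A n) 3 ≃+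
      groupCohomology (quotRep A n) 2) : Prop where
  map_left : ∀ α, Φ (α, 0) = reduction A n α
  connecting_map : ∀ α β, connecting A n (Φ (α, β)) = β
  map_right : ∀ β, ∃ z : groupCohomology.cocycles₂ (quotRep A n),
    groupCohomology.H2π (quotRep A n) z = Φ (0, β) ∧
    ∀ g h : R, ∃ t : A, z (g, h) = (lowerSeries A n).mkQ t ∧
      AddMonoid.exponent (groupCohomology (subRep A n) 3) • t ∈ lowerSeries A n

end Series

section Comp

variable {k R : Type} [CommRing k] [Group R]

/-- The group `Comp(R, V)` of compatible pairs `(β, ε)` in `Aut R × Aut V`: the action of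
`β g` on `V` is the conjugate under `ε` of the action of `g`, for all `g ∈ R`. -/
def Comp (V : Rep.{0} k R) : Subgroup (MulAut R × (V ≃ₗ[k] V)) where
  carrier := {c | ∀ (g : R) (v : V), c.2 (V.ρ g v) = V.ρ (c.1 g) (c.2 v)}
  one_mem' := fun _ _ => rfl
  mul_mem' := fun {a b} ha hb g v => by
    change a.2 (b.2 _) = V.ρ (a.1 (b.1 g)) (a.2 (b.2 v))
    rw [hb, ha]
  inv_mem' := fun {a} ha g v => by
    change a.2.symm _ = V.ρ (a.1.symm g) (a.2.symm v)
    rw [LinearEquiv.symm_apply_eq, ha]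
    simp

/-- The automorphism of `H²(R, V)` induced by `(β, ε)`, given on cocycles by
`γ ↦ ((g, h) ↦ ε (γ (β⁻¹ g, β⁻¹ h)))`. -/
noncomputable def compMap (V : Rep.{0} k R) (c : Comp V) :
    groupCohomology V 2 ⟶ groupCohomology V 2 :=
  groupCohomology.map (c.1.1⁻¹ : MulAut R).toMonoidHom
    (Rep.ofHom ⟨c.1.2.toLinearMap, fun g => by
      ext v
      have := c.2 (c.1.1⁻¹ g) v
      rwa [MulAut.apply_inv_self] at this⟩) 2

noncomputable instance (V : Rep.{0} k R) : MulAction (Comp V) (groupCohomology V 2) where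
  smul c x := (compMap V c).hom x
  one_smul x := by
    have : compMap V 1 = 𝟙 _ :=
      (groupCohomology.map_congr (f := (1 : Comp V).1.1⁻¹.toMonoidHom) (g := MonoidHom.id R)
        (ψ := 𝟙 V) rfl rfl 2).trans (groupCohomology.map_id 2)
    change (compMap V 1).hom x = x
    rw [this]
    rfl
  mul_smul a b x := by
    have : compMap V (a * b) = compMap V b ≫ compMap V a := by
      rw [compMap, compMap, compMap, ← groupCohomology.map_comp]
      exact groupCohomology.map_congr (MonoidHom.ext fun g => by simp) rfl 2
    change (compMap V (a * b)).hom x = (compMap V a).hom ((compMap V b).hom x)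
    rw [this]
    rfl

/-- The set of `Comp(R, V)`-orbits of `H²(R, V)`. -/
abbrev Orbits (V : Rep.{0} k R) : Type :=
  MulAction.orbitRel.Quotient (Comp V) (groupCohomology V 2)

end Comp

section Multiplication

lemma exists_hom_zmod_ne_zero (p : ℕ) [Fact p.Prime] (M : Type) [AddCommGroup M]
    [Module (ZMod p) M] [Nontrivial M] : ∃ l : M →+ ZMod p, l ≠ 0 := by
  obtain ⟨m, hm⟩ := exists_ne (0 : M)
  obtain ⟨f, hf⟩ := Module.Projective.exists_dual_ne_zero (ZMod p) hm
  exact ⟨LinearMap.toAddMonoidHom f, fun h0 => hf (DFunLike.congr_fun h0 m)⟩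

lemma subsingleton_of_closure_eq_top {R M : Type} [Group R] (p : ℕ) [Fact p.Prime]
    (hR : IsPGroup p R) [AddCommGroup M] [Finite M] (ρ : R → M →+ M)
    (ρ_one : ∀ m, ρ 1 m = m) (ρ_mul : ∀ a b m, ρ (a * b) m = ρ a (ρ b m))
    (hp : ∀ m : M, p • m = 0)
    (h : ∀ m : M, m ∈ AddSubgroup.closure {x | ∃ v, ∃ g : R, x = ρ g v - v}) :
    Subsingleton M := by
  by_contra hM
  rw [not_subsingleton_iff_nontrivial] at hM
  let _ : Module (ZMod p) M := AddCommGroup.zmodModule hp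
  let _ : MulAction R (M →+ ZMod p) :=
    { smul := fun g l => l.comp (ρ g⁻¹)
      one_smul := fun l => by
        change l.comp (ρ 1⁻¹) = l
        ext; simp [ρ_one]
      mul_smul := fun a b l => by
        change l.comp (ρ (a * b)⁻¹) = (l.comp (ρ b⁻¹)).comp (ρ a⁻¹)
        ext; simp [mul_inv_rev, ρ_mul] }
  have : Finite (M →+ ZMod p) := DFunLike.finite _
  obtain ⟨l, hl⟩ := exists_hom_zmod_ne_zero p M
  have hcard : p ∣ Nat.card (M →+ ZMod p) := by
    have h1 : addOrderOf l = p := addOrderOf_eq_prime (by ext m; simp) hl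
    have h2 := addOrderOf_dvd_natCard l
    rwa [h1] at h2
  obtain ⟨f, hf, hf0⟩ := hR.exists_fixed_point_of_prime_dvd_card_of_fixed_point _ hcard
    (a := 0) (fun g => rfl)
  refine hf0 (Eq.symm ?_)
  refine AddMonoidHom.ext fun m => ?_
  have hle : AddSubgroup.closure {x | ∃ v, ∃ g : R, x = ρ g v - v} ≤ f.ker := by
    rw [AddSubgroup.closure_le]
    rintro _ ⟨v, g, rfl⟩
    have := DFunLike.congr_fun (hf g⁻¹) v
    change f (ρ g⁻¹⁻¹ v) = f v at this
    rw [inv_inv] at this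
    simp [AddMonoidHom.mem_ker, this]
  exact hle (h m)


lemma le_of_closure_sup {R T : Type} [Group R] (p : ℕ) [Fact p.Prime] (hR : IsPGroup p R)
    [AddCommGroup T] [DistribMulAction R T] (N P : AddSubgroup T)
    (hN : ∀ g : R, ∀ v ∈ N, g • v ∈ N) (hP : ∀ g : R, ∀ v ∈ P, g • v ∈ P)
    (hpN : ∀ v ∈ N, p • v ∈ P) (hfin : P.relIndex N ≠ 0)
    (h : N ≤ AddSubgroup.closure {x | ∃ v ∈ N, ∃ g : R, x = g • v - v} ⊔ P) : N ≤ P := by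
  let res (g : R) : N →+ N :=
    { toFun := fun v => ⟨g • v.1, hN g v.1 v.2⟩
      map_zero' := by ext; simp
      map_add' := by intros; ext; simp }
  let ρ (g : R) : N ⧸ P.addSubgroupOf N →+ N ⧸ P.addSubgroupOf N :=
    QuotientAddGroup.map _ _ (res g) (fun v hv => hP g v.1 hv)
  have : (P.addSubgroupOf N).FiniteIndex := ⟨hfin⟩
  have hfin' : Finite (N ⧸ P.addSubgroupOf N) := inferInstance
  have := subsingleton_of_closure_eq_top p hR ρ
    (fun m => by
      induction m using QuotientAddGroup.induction_on with
      | H v => exact congrArg _ (Subtype.ext (one_smul R v.1)))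
    (fun a b m => by
      induction m using QuotientAddGroup.induction_on with
      | H v => exact congrArg _ (Subtype.ext (mul_smul a b v.1)))
    (fun m => by
      induction m using QuotientAddGroup.induction_on with
      | H v => exact (QuotientAddGroup.eq_zero_iff (p • v)).2 (hpN v.1 v.2))
    (fun m => by
      induction m using QuotientAddGroup.induction_on with
      | H v =>
        obtain ⟨y, hy, z, hz, hyz⟩ := AddSubgroup.mem_sup.1 (h v.2)
        have key : ∀ y ∈ AddSubgroup.closure {x | ∃ v ∈ N, ∃ g : R, x = g • v - v},
            ∃ hy : y ∈ N, (QuotientAddGroup.mk ⟨y, hy⟩ : N ⧸ P.addSubgroupOf N) ∈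
              AddSubgroup.closure {x | ∃ v, ∃ g : R, x = ρ g v - v} := by
          intro y hy
          induction hy using AddSubgroup.closure_induction with
          | mem x hx =>
            obtain ⟨v, hv, g, rfl⟩ := hx
            exact ⟨sub_mem (hN g v hv) hv, AddSubgroup.subset_closure
              ⟨QuotientAddGroup.mk ⟨v, hv⟩, g, rfl⟩⟩
          | zero => exact ⟨zero_mem _, zero_mem _⟩
          | add x y _ _ hx hy =>
            obtain ⟨hx, hx'⟩ := hx
            obtain ⟨hy, hy'⟩ := hy
            exact ⟨add_mem hx hy, add_mem hx' hy'⟩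
          | neg x _ hx =>
            obtain ⟨hx, hx'⟩ := hx
            exact ⟨neg_mem hx, neg_mem hx'⟩
        obtain ⟨hyN, hy'⟩ := key y hy
        convert hy' using 1
        refine QuotientAddGroup.eq.2 ?_
        change -v.1 + y ∈ P
        rw [← hyz]
        simpa using hz)
  intro v hv
  exact (QuotientAddGroup.eq_zero_iff (⟨v, hv⟩ : N)).1 (Subsingleton.elim (α := N ⧸ P.addSubgroupOf N) _ _)


lemma index_range_nsmul (p : ℕ) [Fact p.Prime] (T : Type) [AddCommGroup T] [Module ℤ_[p] T]
    [Module.Free ℤ_[p] T] [Module.Finite ℤ_[p] T] :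
    (nsmulAddMonoidHom (α := T) p).range.index = p ^ Module.finrank ℤ_[p] T := by
  let b := (Module.finBasis ℤ_[p] T).equivFun
  let φ : T →+ (Fin (Module.finrank ℤ_[p] T) → ZMod p) :=
    { toFun := fun t i => PadicInt.toZMod (b t i)
      map_zero' := by ext; simp
      map_add' := by intros; ext; simp }
  have hφ : Function.Surjective φ := by
    intro v
    choose w hw using fun i => ZMod.ringHom_surjective (PadicInt.toZMod (p := p)) (v i)
    refine ⟨b.symm w, funext fun i => ?_⟩
    change PadicInt.toZMod (b (b.symm w) i) = v i
    rw [LinearEquiv.apply_symm_apply, hw]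
  have hk : φ.ker = (nsmulAddMonoidHom (α := T) p).range := by
    ext t
    constructor
    · intro ht
      have : ∀ i, ∃ c : ℤ_[p], b t i = p * c := by
        intro i
        have h1 : b t i ∈ RingHom.ker (PadicInt.toZMod (p := p)) := congrFun ht i
        rw [PadicInt.ker_toZMod, PadicInt.maximalIdeal_eq_span_p] at h1
        exact Ideal.mem_span_singleton.1 h1
      choose c hc using this
      refine ⟨b.symm c, b.injective (funext fun i => ?_)⟩
      change b (p • b.symm c) i = _
      rw [map_nsmul, LinearEquiv.apply_symm_apply, hc, Pi.smul_apply, nsmul_eq_mul]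
    · rintro ⟨s, rfl⟩
      refine funext fun i => ?_
      change PadicInt.toZMod (b (p • s) i) = 0
      rw [map_nsmul, Pi.smul_apply, map_nsmul]
      simp
  rw [← hk, AddSubgroup.index_ker, φ.range_eq_top_of_surjective hφ]
  simp [Nat.card_eq_fintype_card]

lemma nsmul_injective (p : ℕ) [Fact p.Prime] (T : Type) [AddCommGroup T] [Module ℤ_[p] T]
    [Module.Free ℤ_[p] T] : Function.Injective (nsmulAddMonoidHom (α := T) p) := by
  intro x y hxy
  have hxy' : (p : ℤ_[p]) • x = (p : ℤ_[p]) • y := by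
    simpa [Nat.cast_smul_eq_nsmul] using hxy
  exact smul_right_injective T
    (Nat.cast_ne_zero.2 (Fact.out : p.Prime).ne_zero : (p : ℤ_[p]) ≠ 0) hxy'

theorem series_add_finrank {R T : Type} [Group R] (p : ℕ) [Fact p.Prime] (hR : IsPGroup p R)
    [AddCommGroup T] [Module ℤ_[p] T] [Module.Free ℤ_[p] T] [Module.Finite ℤ_[p] T]
    [DistribMulAction R T] (L : ℕ → AddSubgroup T) (h0 : L 0 = ⊤)
    (hs : ∀ i, L (i + 1) = AddSubgroup.closure {x | ∃ v ∈ L i, ∃ g : R, x = g • v - v})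
    (hst : ∀ i, ∀ g : R, ∀ v ∈ L i, g • v ∈ L i)
    (hu : ∀ i, L i ≠ ⊥ → (L (i + 1)).relIndex (L i) = p) (n : ℕ) :
    L (n + Module.finrank ℤ_[p] T) = (L n).map (nsmulAddMonoidHom p) := by
  set d := Module.finrank ℤ_[p] T with hd
  have hpr : p.Prime := Fact.out
  rcases subsingleton_or_nontrivial T with hT | hT
  · ext x
    simp [Subsingleton.elim x 0, zero_mem]
  have hinf : Infinite T := by
    have : Module.IsTorsionFree ℤ_[p] T := inferInstance
    exact Module.Free.infinite ℤ_[p] T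
  have hidx : ∀ i, (L i).index = p ^ i := by
    intro i
    induction i with
    | zero => simp [h0]
    | succ i ih =>
      have hle : L (i + 1) ≤ L i := by
        rw [hs, AddSubgroup.closure_le]
        rintro _ ⟨v, hv, g, rfl⟩
        exact sub_mem (hst i g v hv) hv
      rw [← AddSubgroup.relIndex_mul_index hle, ih, hu i, pow_succ, mul_comm]
      intro hb
      rw [hb, AddSubgroup.index_bot, Nat.card_eq_zero_of_infinite] at ih
      exact (pow_pos hpr.pos i).ne ih
  have hinj := nsmul_injective p T
  set P := (L n).map (nsmulAddMonoidHom p) with hP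
  have hPidx : P.index = p ^ (n + d) := by
    rw [hP, AddSubgroup.index_map_of_injective _ hinj, hidx, index_range_nsmul, pow_add]
  have hPL : P ≤ L n := by
    rintro _ ⟨v, hv, rfl⟩
    exact nsmul_mem hv p
  have hPst : ∀ g : R, ∀ v ∈ P, g • v ∈ P := by
    rintro g _ ⟨v, hv, rfl⟩
    exact ⟨g • v, hst n g v hv, smul_comm p g v⟩
  have hsle : ∀ i, L (i + 1) ≤ L i := by
    intro i
    rw [hs, AddSubgroup.closure_le]
    rintro _ ⟨v, hv, g, rfl⟩
    exact sub_mem (hst i g v hv) hv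
  have hanti : Antitone L := antitone_nat_of_succ_le hsle
  have hK : ∀ i, P.relIndex (L (n + i) ⊔ P) ∣ p ^ (d - i) := by
    intro i
    induction i with
    | zero =>
      have h1 := AddSubgroup.relIndex_mul_index hPL
      rw [hidx, hPidx, add_comm n d, pow_add] at h1
      rw [add_zero, sup_eq_left.2 hPL, Nat.eq_of_mul_eq_mul_right (pow_pos hpr.pos n) h1]
      simp
    | succ i ih =>
      have hmono : L (n + (i + 1)) ⊔ P ≤ L (n + i) ⊔ P := sup_le_sup_right (hsle (n + i)) P
      by_cases hone : P.relIndex (L (n + i) ⊔ P) = 1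
      · have h2 : L (n + i) ⊔ P ≤ P := AddSubgroup.relIndex_eq_one.1 hone
        rw [AddSubgroup.relIndex_eq_one.2 (hmono.trans h2)]
        exact one_dvd _
      · have hmul := AddSubgroup.relIndex_mul_relIndex P _ _
          (le_sup_right : P ≤ L (n + (i + 1)) ⊔ P) hmono
        have hne : (L (n + (i + 1)) ⊔ P).relIndex (L (n + i) ⊔ P) ≠ 1 := by
          intro h1
          have h2 := AddSubgroup.relIndex_eq_one.1 h1
          refine hone (AddSubgroup.relIndex_eq_one.2 ?_)
          refine le_of_closure_sup p hR (L (n + i) ⊔ P) P ?_ hPst ?_ ?_ ?_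
          · intro g v hv
            obtain ⟨y, hy, z, hz, rfl⟩ := AddSubgroup.mem_sup.1 hv
            rw [smul_add]
            exact AddSubgroup.add_mem_sup (hst _ g y hy) (hPst g z hz)
          · intro v hv
            exact ⟨v, sup_le (hanti (Nat.le_add_right n i)) hPL hv, rfl⟩
          · exact fun h0 => (pow_pos hpr.pos (d - i)).ne' (Nat.eq_zero_of_zero_dvd (h0 ▸ ih))
          · refine h2.trans (sup_le_sup_right ?_ P)
            rw [← add_assoc, hs]
            refine AddSubgroup.closure_mono ?_
            rintro _ ⟨v, hv, g, rfl⟩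
            exact ⟨v, AddSubgroup.mem_sup_left hv, g, rfl⟩
        rw [← hmul] at ih
        obtain ⟨e, he, he'⟩ := (Nat.dvd_prime_pow hpr).1 ((Dvd.intro_left _ rfl).trans ih)
        have he0 : e ≠ 0 := fun h => hne (by rw [he', h, pow_zero])
        obtain ⟨e, rfl⟩ := Nat.exists_eq_succ_of_ne_zero he0
        obtain ⟨c, hc⟩ : ∃ c, d - i = c + 1 := Nat.exists_eq_succ_of_ne_zero (by omega)
        have hdi : d - (i + 1) = c := by omega
        rw [hdi]
        rw [he', hc, pow_succ, pow_succ, ← mul_assoc] at ih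
        exact (Dvd.intro _ rfl).trans (Nat.dvd_of_mul_dvd_mul_right hpr.pos ih)
  have hle : L (n + d) ≤ P := by
    have h1 := hK d
    rw [Nat.sub_self, pow_zero, Nat.dvd_one, AddSubgroup.relIndex_eq_one] at h1
    exact le_sup_left.trans h1
  refine le_antisymm hle ?_
  have h1 := AddSubgroup.relIndex_mul_index hle
  rw [hidx, hPidx] at h1
  exact AddSubgroup.relIndex_eq_one.1 (Nat.eq_of_mul_eq_mul_right (pow_pos hpr.pos (n + d))
    (h1.trans (one_mul _).symm))

variable (p : ℕ) (R T : Type) [Group R] [AddCommGroup T] [DistribMulAction R T]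

/-- An additive group `T` with an action of `R` by automorphisms, as an `R`-module. -/
noncomputable abbrev asRep : Rep.{0} ℤ R := Rep.of (Representation.ofDistribMulAction ℤ R T)

variable {p R T} [Fact p.Prime] [Module ℤ_[p] T] [Module.Free ℤ_[p] T] [Module.Finite ℤ_[p] T]

/-- For a finite `p`-group `R` acting uniserially on a free `ℤ_p`-module `T` of rank `d`, one has
`T_{n+d} = p T_n`. -/
theorem lowerSeries_add_finrank (hR : IsPGroup p R) (hT : IsUniserial p (asRep R T)) (n : ℕ) :
    (lowerSeries (asRep R T) (n + Module.finrank ℤ_[p] T)).toAddSubgroup =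
      (lowerSeries (asRep R T) n).toAddSubgroup.map (nsmulAddMonoidHom p) := by
  refine series_add_finrank p hR (fun i => (lowerSeries (asRep R T) i).toAddSubgroup) rfl
    (fun i => ?_) (fun i g v hv => lowerSeries_le_comap (asRep R T) i g hv)
    (fun i hi => hT i fun h => hi (by rw [h]; rfl)) n
  · rw [lowerSeries, Submodule.span_int_eq_addSubgroupClosure]
    rfl

/-- The additive isomorphism `T_n ≃ T_{n+d}`, `t ↦ p t`. -/
noncomputable def mulPEquiv (hR : IsPGroup p R) (hT : IsUniserial p (asRep R T)) (n : ℕ) :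
    lowerSeries (asRep R T) n ≃ₗ[ℤ]
      lowerSeries (asRep R T) (n + Module.finrank ℤ_[p] T) :=
  LinearEquiv.ofBijective
    { toFun := fun t => ⟨(p : ℤ) • t.1, by
        change _ ∈ (lowerSeries (asRep R T) (n + Module.finrank ℤ_[p] T)).toAddSubgroup
        rw [lowerSeries_add_finrank hR hT]
        exact ⟨t.1, t.2, (natCast_zsmul t.1 p).symm⟩⟩
      map_add' := fun x y => Subtype.ext (smul_add (p : ℤ) x.1 y.1)
      map_smul' := fun z x => Subtype.ext (smul_comm (p : ℤ) z x.1) }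
    ⟨fun x y hxy => by
      have h1 : (p : ℤ) • x.1 = (p : ℤ) • y.1 := congrArg Subtype.val hxy
      refine Subtype.ext ?_
      exact nsmul_injective p T
        ((natCast_zsmul x.1 p).symm.trans (h1.trans (natCast_zsmul y.1 p))),
    fun y => by
      have h1 : y.1 ∈ (lowerSeries (asRep R T) (n + Module.finrank ℤ_[p] T)).toAddSubgroup := y.2
      rw [lowerSeries_add_finrank hR hT] at h1
      obtain ⟨t, ht, hty⟩ := h1
      exact ⟨⟨t, ht⟩, Subtype.ext ((natCast_zsmul t p).trans hty)⟩⟩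

/-- The isomorphism of `R`-modules `T_n ≃ T_{n+d}`, `t ↦ p t`. -/
noncomputable def mulP (hR : IsPGroup p R) (hT : IsUniserial p (asRep R T)) (n : ℕ) :
    subRep (asRep R T) n ≅ subRep (asRep R T) (n + Module.finrank ℤ_[p] T) :=
  Rep.mkIso <| .mk (mulPEquiv hR hT n)
    (fun g => LinearMap.ext fun x => Subtype.ext (smul_comm (p : ℤ) g x.1))

/-- The isomorphism `μ : H³(R, T_n) ≃ H³(R, T_{n+d})` induced by `T_n → T_{n+d}`, `t ↦ p t`. -/
noncomputable def mu (hR : IsPGroup p R) (hT : IsUniserial p (asRep R T)) (n : ℕ) :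
    groupCohomology (subRep (asRep R T) n) 3 ≃+
      groupCohomology (subRep (asRep R T) (n + Module.finrank ℤ_[p] T)) 3 :=
  ((groupCohomology.functor ℤ R 3).mapIso (mulP hR hT n)).toLinearEquiv.toAddEquiv

/-- The isomorphism `id ⊕ μ : H²(R, T / T_n) ≃ H²(R, T / T_{n+d})`, formed with respect to
decompositions `Φ` of `H²(R, T / T_n)` and `Φ'` of `H²(R, T / T_{n+d})`. -/
noncomputable def idPlusMu (hR : IsPGroup p R) (hT : IsUniserial p (asRep R T)) {n : ℕ}
    (Φ : groupCohomology (asRep R T) 2 × groupCohomology (subRep (asRep R T) n) 3 ≃+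
      groupCohomology (quotRep (asRep R T) n) 2)
    (Φ' : groupCohomology (asRep R T) 2 ×
        groupCohomology (subRep (asRep R T) (n + Module.finrank ℤ_[p] T)) 3 ≃+
      groupCohomology (quotRep (asRep R T) (n + Module.finrank ℤ_[p] T)) 2) :
    groupCohomology (quotRep (asRep R T) n) 2 ≃+
      groupCohomology (quotRep (asRep R T) (n + Module.finrank ℤ_[p] T)) 2 :=
  Φ.symm.trans (((AddEquiv.refl _).prodCongr (mu hR hT n)).trans Φ')

end Multiplication

end UniserialCohomology

/-!
Let `q = |R|`, a power of `p`. For large `n` the submodule `q⁻¹ T_n` lies in `q T` (`IsDeep`),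
because `T_{n+d} = p T_n`. As `q` annihilates cohomology in positive degrees
(`card_nsmul_eq_zero`), every inclusion of a submodule of `q T` into `T` induces zero there.

For a divisor `f` of `q`, consider the classes in `H²(R, T / T_n)` represented by cocycles with
values in `f⁻¹ T_n / T_n` (`divClasses`), and compare the long exact sequences of `T_n → f⁻¹ T_n`
and `T_n → T`. The map `T_n → f⁻¹ T_n` is multiplication by `f` on `T_n` up to isomorphism, so if
`f` annihilates `H³(R, T_n)`, then the connecting homomorphism maps these classes onto `H³(R,
T_n)` (`exists_mem_divClasses`). For `f = q` it is injective on them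
(`eq_zero_of_mem_divClasses`), because `H²(R, q⁻¹ T_n) → H²(R, T)` vanishes. So the classes for
the exponent of `H³(R, T_n)` and those for `q` coincide, and they form the only complement of the
image of `H²(R, T)` that a canonical isomorphism can use (`IsDeep.existsUnique_isCanonical`).

A compatible pair `(β, ε)` of `T / T_n` is induced by a map `E + φ` of `T`, where `E` is
equivariant along `β` and `φ` has values in `q⁻¹ T_n` and is equivariant along `β` modulo `T_n`:
lift `ε` to an additive map of `T`, average it over `R` and divide by `q` (`exists_isLift`). As
`φ` vanishes on `q⁻¹ T_n` modulo `T_n`, and as the map `H²(R, T) → H²(R, T / T_n)` induced by `φ`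
has its image in the canonical complement, the pair acts in terms of the canonical isomorphism by
`(α, γ) ↦ (E α, E γ + δ (φ α))`, with `δ` the connecting homomorphism (`IsLift.map_apply`). The
map `E + p φ` induces a compatible pair of `T / T_{n+d}` with the same `E` whose off-diagonal term
is `μ (δ (φ α))`, so that `id ⊕ μ` carries the action of the first pair to that of the second
(`idPlusMu_map`). Conversely, a pair of `T / T_{n+d}` is induced by some `E + ψ`, and `ψ` is
divisible by `p`. Both `E + φ` and `E + p φ` are congruent to `E` modulo `p`, so one is surjective
modulo the relevant term of the series if and only if the other is.
-/

open CategoryTheory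

namespace UniserialCohomology

/-! ### Maps in cohomology along homomorphisms of groups -/

section TwistedHom

variable {k G H K : Type} [CommRing k] [Group G] [Group H] [Group K]

/-- A linear map `A → B` from a `G`-module to an `H`-module that is equivariant along a
homomorphism `f : H →* G`. -/
structure TwistedHom (f : H →* G) (A : Rep.{0} k G) (B : Rep.{0} k H) where
  /-- The underlying linear map. -/
  toLin : A →ₗ[k] B
  comm : ∀ g v, toLin (A.ρ (f g) v) = B.ρ g (toLin v)

namespace TwistedHom

variable {f : H →* G} {A : Rep.{0} k G} {B : Rep.{0} k H}

/-- A twisted homomorphism as a morphism from the restriction along `f`. -/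
noncomputable def toHom (φ : TwistedHom f A B) : Rep.res f A ⟶ B :=
  Rep.ofHom (σ := B.ρ) ⟨φ.toLin, fun g => LinearMap.ext fun v => φ.comm g v⟩

/-- A morphism of `G`-modules, as a map equivariant along the identity. -/
def ofHom {A B : Rep.{0} k G} (φ : A ⟶ B) : TwistedHom (MonoidHom.id G) A B :=
  ⟨φ.hom.toLinearMap, fun g v => Rep.hom_comm_apply φ g v⟩

/-- The map induced in cohomology, `c ↦ φ ∘ c ∘ f` on cochains. -/
noncomputable def map (φ : TwistedHom f A B) (n : ℕ) :
    groupCohomology A n →+ groupCohomology B n :=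
  (groupCohomology.map (A := A) (B := B) f φ.toHom n).hom.toAddMonoidHom

/-- The map induced on `2`-cocycles. -/
noncomputable def mapCocycles (φ : TwistedHom f A B) (z : groupCohomology.cocycles₂ A) :
    groupCohomology.cocycles₂ B :=
  (groupCohomology.mapCocycles₂ (A := A) (B := B) f φ.toHom).hom z

lemma mapCocycles_apply (φ : TwistedHom f A B) (z : groupCohomology.cocycles₂ A) (g h : H) :
    φ.mapCocycles z (g, h) = φ.toLin (z (f g, f h)) := rfl

lemma map_H2π (φ : TwistedHom f A B) (z : groupCohomology.cocycles₂ A) :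
    φ.map 2 (groupCohomology.H2π A z) = groupCohomology.H2π B (φ.mapCocycles z) :=
  groupCohomology.H2π_comp_map_apply (A := A) (B := B) f φ.toHom z

lemma map_map {A : Rep.{0} k K} {B : Rep.{0} k G} {C : Rep.{0} k H} {f : G →* K} {g : H →* G}
    {e : H →* K} (φ : TwistedHom f A B) (ψ : TwistedHom g B C) (χ : TwistedHom e A C)
    (he : e = f.comp g) (h : ∀ v, χ.toLin v = ψ.toLin (φ.toLin v)) (n : ℕ)
    (x : groupCohomology A n) : ψ.map n (φ.map n x) = χ.map n x := by
  subst he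
  have h' : χ.toHom = (Rep.resFunctor g).map φ.toHom ≫ ψ.toHom :=
    Rep.hom_ext (Representation.IntertwiningMap.ext (LinearMap.ext h))
  rw [map, map, map, h', groupCohomology.map_comp]
  rfl

lemma map_add {φ ψ χ : TwistedHom f A B} (h : ∀ v, χ.toLin v = φ.toLin v + ψ.toLin v) (n : ℕ)
    (x : groupCohomology A n) : χ.map n x = φ.map n x + ψ.map n x := by
  have h' : χ.toHom = φ.toHom + ψ.toHom :=
    Rep.hom_ext (Representation.IntertwiningMap.ext (LinearMap.ext h))
  have h : groupCohomology.cochainsMap (A := A) (B := B) f (φ.toHom + ψ.toHom) =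
      groupCohomology.cochainsMap f φ.toHom + groupCohomology.cochainsMap f ψ.toHom := rfl
  rw [map, h', groupCohomology.map, h, HomologicalComplex.homologyMap_add]
  rfl

lemma map_id {φ : TwistedHom (MonoidHom.id G) A A} (h : ∀ v, φ.toLin v = v) (n : ℕ)
    (x : groupCohomology A n) : φ.map n x = x := by
  have h' : φ.toHom = 𝟙 A :=
    Rep.hom_ext (Representation.IntertwiningMap.ext (LinearMap.ext h))
  rw [map, h', groupCohomology.map_id]
  rfl

/-- Multiplication by `m`. -/
def nsmul (A : Rep.{0} k G) (m : ℕ) : TwistedHom (MonoidHom.id G) A A :=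
  ⟨m • LinearMap.id, fun g v => (map_nsmul (A.ρ g) m v).symm⟩

lemma map_nsmul (m n : ℕ) (x : groupCohomology A n) :
    (nsmul A m).map n x = m • x := by
  induction m with
  | zero =>
    have h := map_add (φ := nsmul A 0) (ψ := nsmul A 0) (χ := nsmul A 0) (fun v => by
      change 0 • v = 0 • v + 0 • v
      simp) n x
    simpa using h
  | succ m ih =>
    rw [map_add (φ := nsmul A m) (ψ := ofHom (𝟙 A)) (fun v => succ_nsmul v m), ih,
      map_id (fun _ => rfl), succ_nsmul]

/-- Naturality of the connecting homomorphism along a homomorphism of groups. -/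
lemma map_δ {X : ShortComplex (Rep.{0} k G)} {Y : ShortComplex (Rep.{0} k H)}
    (hX : X.ShortExact) (hY : Y.ShortExact) (φ₁ : TwistedHom f X.X₁ Y.X₁)
    (φ₂ : TwistedHom f X.X₂ Y.X₂) (φ₃ : TwistedHom f X.X₃ Y.X₃)
    (h₁₂ : ∀ v, φ₂.toLin (X.f.hom v) = Y.f.hom (φ₁.toLin v))
    (h₂₃ : ∀ v, φ₃.toLin (X.g.hom v) = Y.g.hom (φ₂.toLin v))
    (i j : ℕ) (hij : i + 1 = j) (x : groupCohomology X.X₃ i) :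
    φ₁.map j (groupCohomology.δ hX i j hij x) = groupCohomology.δ hY i j hij (φ₃.map i x) := by
  let F : X.map (groupCohomology.cochainsFunctor k G) ⟶
      Y.map (groupCohomology.cochainsFunctor k H) :=
    { τ₁ := groupCohomology.cochainsMap (A := X.X₁) (B := Y.X₁) f φ₁.toHom
      τ₂ := groupCohomology.cochainsMap (A := X.X₂) (B := Y.X₂) f φ₂.toHom
      τ₃ := groupCohomology.cochainsMap (A := X.X₃) (B := Y.X₃) f φ₃.toHom
      comm₁₂ := by
        ext i x
        funext g
        exact (h₁₂ _).symm
      comm₂₃ := by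
        ext i x
        funext g
        exact (h₂₃ _).symm }
  exact congrArg (fun F => F.hom x) (HomologicalComplex.HomologySequence.δ_naturality F
    (groupCohomology.map_cochainsFunctor_shortExact hX)
    (groupCohomology.map_cochainsFunctor_shortExact hY) i j hij)

end TwistedHom

end TwistedHom

/-! ### The order of the group annihilates cohomology -/

section Transfer

variable {k G : Type} [CommRing k] [Group G]

/-- The trace from the module coinduced from the trivial subgroup, `f ↦ ∑ g, g⁻¹ f(g)`. -/
noncomputable def coindTrace [Fintype G] (A : Rep.{0} k G) :
    Rep.coind (⊥ : Subgroup G).subtype (Rep.res (⊥ : Subgroup G).subtype A) ⟶ A :=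
  Rep.ofHom (σ := A.ρ) ⟨∑ g : G, A.ρ g⁻¹ ∘ₗ LinearMap.proj g ∘ₗ Submodule.subtype _, fun h => by
    ext f
    simp only [LinearMap.comp_apply, LinearMap.sum_apply, map_sum]
    refine Fintype.sum_equiv (Equiv.mulRight h) _ _ fun g => ?_
    change A.ρ g⁻¹ (f.1 (g * h)) = A.ρ h (A.ρ (g * h)⁻¹ (f.1 (g * h)))
    rw [← Module.End.mul_apply, ← map_mul]
    simp⟩

/-- Multiplication by `|G|` factors through the module coinduced from the trivial subgroup, whose
cohomology vanishes in positive degrees by Shapiro's lemma. -/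
theorem card_nsmul_eq_zero [Finite G] (A : Rep.{0} k G) (n : ℕ)
    (x : groupCohomology A (n + 1)) : Nat.card G • x = 0 := by
  have := Fintype.ofFinite G
  let C := Rep.coind (⊥ : Subgroup G).subtype (Rep.res (⊥ : Subgroup G).subtype A)
  let i : A ⟶ C := Rep.resCoindToHom _ A _ (𝟙 _)
  have hi : ∀ v, (coindTrace A).hom (i.hom v) = Nat.card G • v := fun v => by
    change (∑ g : G, A.ρ g⁻¹ ∘ₗ LinearMap.proj g ∘ₗ Submodule.subtype _) (i.hom v) = _
    simp only [LinearMap.sum_apply, LinearMap.comp_apply]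
    rw [Nat.card_eq_fintype_card, ← Finset.card_univ, ← Finset.sum_const]
    refine Finset.sum_congr rfl fun g _ => ?_
    change A.ρ g⁻¹ (A.ρ g v) = v
    rw [← Module.End.mul_apply, ← map_mul]
    simp
  have hz : Limits.IsZero (groupCohomology C (n + 1)) :=
    (isZero_groupCohomology_succ_of_subsingleton _ n).of_iso (groupCohomology.coindIso _ _)
  have : Subsingleton (groupCohomology C (n + 1)) := ModuleCat.subsingleton_of_isZero hz
  rw [← TwistedHom.map_nsmul, ← TwistedHom.map_map (TwistedHom.ofHom i)
    (TwistedHom.ofHom (coindTrace A)) _ rfl (fun v => (hi v).symm),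
    Subsingleton.elim ((TwistedHom.ofHom i).map (n + 1) x) 0, map_zero]

end Transfer

/-! ### Classes with values in `f⁻¹ A_n / A_n` -/

section Division

variable {k G : Type} [CommRing k] [Group G]

lemma exists_nsmul_eq {M A : Type} [AddCommGroup M] [Module k M] [AddCommGroup A] [Module k A]
    {q : ℕ} (hq : Function.Injective fun t : A => q • t) (l : M →ₗ[k] A)
    (h : ∀ v, ∃ s, l v = q • s) : ∃ m : M →ₗ[k] A, ∀ v, l v = q • m v := by
  choose m hm using h
  refine ⟨⟨⟨m, fun x y => hq ?_⟩, fun c x => hq ?_⟩, hm⟩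
  · change q • m (x + y) = q • (m x + m y)
    rw [smul_add, ← hm, ← hm, ← hm, map_add]
  · change q • m (c • x) = q • c • m x
    rw [smul_comm, ← hm, ← hm, map_smul]

/-- The inclusion of a submodule of `|G| A` factors through multiplication by `|G|` on `A`. -/
lemma map_subtype_eq_zero [Finite G] (A : Rep.{0} k G)
    (hq : Function.Injective fun t : A => Nat.card G • t)
    (B : Submodule k A) (hB : ∀ g, B ≤ B.comap (A.ρ g)) (h : ∀ t ∈ B, ∃ s, t = Nat.card G • s)
    (n : ℕ) (x : groupCohomology (A.subrepresentation B hB) (n + 1)) :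
    (TwistedHom.ofHom (A.subtype B hB)).map (n + 1) x = 0 := by
  obtain ⟨m, hm⟩ := exists_nsmul_eq hq B.subtype fun v => h v.1 v.2
  let φ : TwistedHom (MonoidHom.id G) (A.subrepresentation B hB) A :=
    ⟨m, fun g v => hq ((hm _).symm.trans
      ((congrArg (A.ρ g) (hm v)).trans (map_nsmul (A.ρ g) _ _)))⟩
  rw [← TwistedHom.map_map φ (TwistedHom.nsmul A (Nat.card G)) _ rfl hm, TwistedHom.map_nsmul,
    card_nsmul_eq_zero]

end Division

section DivClasses

variable {k G : Type} [CommRing k] [Group G] (A : Rep.{0} k G) (n f : ℕ)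

/-- The submodule `f⁻¹ A_n` of all `t ∈ A` with `f t ∈ A_n`. -/
def divSeries : Submodule k A := (lowerSeries A n).comap (f • LinearMap.id)

lemma divSeries_le_comap (g : G) : divSeries A n f ≤ (divSeries A n f).comap (A.ρ g) := by
  intro t ht
  change f • A.ρ g t ∈ lowerSeries A n
  rw [← map_nsmul]
  exact lowerSeries_le_comap A n g ht

lemma lowerSeries_le_divSeries : lowerSeries A n ≤ divSeries A n f :=
  fun _ ht => (lowerSeries A n).smul_of_tower_mem f ht

lemma map_mkQ_divSeries_le_comap (g : G) :
    (divSeries A n f).map (lowerSeries A n).mkQ ≤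
      ((divSeries A n f).map (lowerSeries A n).mkQ).comap ((quotRep A n).ρ g) := by
  rintro _ ⟨v, hv, rfl⟩
  exact ⟨A.ρ g v, divSeries_le_comap A n f g hv, rfl⟩

/-- The `G`-module `f⁻¹ A_n / A_n`, as a submodule of `A / A_n`. -/
noncomputable abbrev divQuotRep : Rep.{0} k G :=
  (quotRep A n).subrepresentation ((divSeries A n f).map (lowerSeries A n).mkQ)
    (map_mkQ_divSeries_le_comap A n f)

/-- The inclusion of `f⁻¹ A_n / A_n` into `A / A_n`. -/
noncomputable def divQuotSubtype : TwistedHom (MonoidHom.id G) (divQuotRep A n f) (quotRep A n) :=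
  TwistedHom.ofHom ((quotRep A n).subtype _ _)

/-- The sequence `0 → A_n → f⁻¹ A_n → f⁻¹ A_n / A_n → 0`. -/
noncomputable def divSeq : ShortComplex (Rep.{0} k G) :=
  ShortComplex.mk (X₁ := subRep A n)
    (X₂ := A.subrepresentation (divSeries A n f) (divSeries_le_comap A n f))
    (X₃ := divQuotRep A n f)
    (Rep.ofHom ⟨Submodule.inclusion (lowerSeries_le_divSeries A n f), fun _ => rfl⟩)
    (Rep.ofHom ⟨(lowerSeries A n).mkQ.restrict fun v hv => ⟨v, hv, rfl⟩, fun _ => rfl⟩)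
    (Rep.hom_ext (Representation.IntertwiningMap.ext (LinearMap.ext fun x =>
      Subtype.ext ((Submodule.Quotient.mk_eq_zero _).2 x.2))))

lemma divSeq_shortExact : (divSeq A n f).ShortExact where
  exact := by
    refine (forget₂ _ (ModuleCat k)).reflects_exact_of_faithful _ ?_
    rw [ShortComplex.moduleCat_exact_iff]
    intro x hx
    exact ⟨⟨x.1, (Submodule.Quotient.mk_eq_zero _).1 (congrArg Subtype.val hx)⟩, rfl⟩
  mono_f := (Rep.mono_iff_injective _).2
    (Submodule.inclusion_injective (lowerSeries_le_divSeries A n f))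
  epi_g := (Rep.epi_iff_surjective _).2 fun ⟨_, v, hv, h⟩ => ⟨⟨v, hv⟩, Subtype.ext h⟩

/-- The classes in `H²(G, A / A_n)` that are represented by cocycles with values in
`f⁻¹ A_n / A_n`. -/
noncomputable def divClasses : AddSubgroup (groupCohomology (quotRep A n) 2) :=
  ((divQuotSubtype A n f).map 2).range

lemma mem_divClasses {x : groupCohomology (quotRep A n) 2} :
    x ∈ divClasses A n f ↔ ∃ z : groupCohomology.cocycles₂ (quotRep A n),
      groupCohomology.H2π (quotRep A n) z = x ∧
      ∀ g h : G, ∃ t : A, z (g, h) = (lowerSeries A n).mkQ t ∧ f • t ∈ lowerSeries A n := by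
  constructor
  · rintro ⟨y, rfl⟩
    induction y using groupCohomology.H2_induction_on with | h y => ?_
    refine ⟨(divQuotSubtype A n f).mapCocycles y, (TwistedHom.map_H2π _ y).symm, fun g h => ?_⟩
    obtain ⟨t, ht, htv⟩ := (y (g, h)).2
    exact ⟨t, htv.symm, ht⟩
  · rintro ⟨z, rfl, hz⟩
    have hz' : ∀ gh, z gh ∈ (divSeries A n f).map (lowerSeries A n).mkQ := fun ⟨g, h⟩ => by
      obtain ⟨t, ht, ht'⟩ := hz g h
      exact ⟨t, ht', ht.symm⟩
    let y : groupCohomology.cocycles₂ (divQuotRep A n f) := ⟨fun gh => ⟨z gh, hz' gh⟩, by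
      rw [groupCohomology.mem_cocycles₂_def]
      intro g h j
      exact Subtype.ext ((groupCohomology.mem_cocycles₂_def z.1).1 z.2 g h j)⟩
    exact ⟨groupCohomology.H2π _ y, TwistedHom.map_H2π _ y⟩

lemma divClasses_mono {f f' : ℕ} (h : f ∣ f') : divClasses A n f ≤ divClasses A n f' := by
  intro x hx
  obtain ⟨z, hz, hz'⟩ := (mem_divClasses A n f).1 hx
  refine (mem_divClasses A n f').2 ⟨z, hz, fun g j => ?_⟩
  obtain ⟨t, ht, ht'⟩ := hz' g j
  obtain ⟨m, rfl⟩ := h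
  refine ⟨t, ht, ?_⟩
  rw [mul_comm, mul_smul]
  exact (lowerSeries A n).smul_of_tower_mem m ht'

lemma connecting_map_divQuotSubtype (y : groupCohomology (divQuotRep A n f) 2) :
    connecting A n ((divQuotSubtype A n f).map 2 y) =
      groupCohomology.δ (divSeq_shortExact A n f) 2 3 rfl y :=
  (TwistedHom.map_δ (divSeq_shortExact A n f) (seriesSeq_shortExact A n)
    (TwistedHom.ofHom (𝟙 (subRep A n))) (TwistedHom.ofHom (A.subtype _ _)) (divQuotSubtype A n f)
    (fun _ => rfl) (fun _ => rfl) 2 3 rfl y).symm.trans (TwistedHom.map_id (fun _ => rfl) _ _)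

/-- A class with values in `|G|⁻¹ A_n / A_n` that is killed by the connecting homomorphism lifts
to `H²(G, |G|⁻¹ A_n)`, whose image in `H²(G, A)` vanishes when `|G|⁻¹ A_n ≤ |G| A`. -/
theorem eq_zero_of_mem_divClasses [Finite G]
    (hq : Function.Injective fun t : A => Nat.card G • t)
    (h : ∀ t, Nat.card G • t ∈ lowerSeries A n → ∃ s, t = Nat.card G • s)
    {x : groupCohomology (quotRep A n) 2} (hx : x ∈ divClasses A n (Nat.card G))
    (hx0 : connecting A n x = 0) : x = 0 := by
  obtain ⟨y, rfl⟩ := hx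
  have h0 := (connecting_map_divQuotSubtype A n _ y).symm.trans hx0
  obtain ⟨w, rfl⟩ := (ShortComplex.moduleCat_exact_iff _).1 (groupCohomology.mapShortComplex₃_exact
    (divSeq_shortExact A n (Nat.card G)) (i := 2) (j := 3) rfl) y h0
  let χ : TwistedHom (MonoidHom.id G) (A.subrepresentation (divSeries A n (Nat.card G))
      (divSeries_le_comap A n _)) (quotRep A n) :=
    ⟨(lowerSeries A n).mkQ ∘ₗ Submodule.subtype _, fun _ _ => rfl⟩
  refine (TwistedHom.map_map (TwistedHom.ofHom (divSeq A n (Nat.card G)).g)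
    (divQuotSubtype A n _) χ rfl (fun _ => rfl) 2 w).trans ?_
  exact (TwistedHom.map_map (TwistedHom.ofHom (A.subtype _ _))
    (TwistedHom.ofHom (seriesSeq A n).g) χ rfl (fun _ => rfl) 2 w).symm.trans
    ((congrArg _ (map_subtype_eq_zero A hq _ _ h 1 w)).trans (map_zero _))

/-- Multiplication by `f` identifies `f⁻¹ A_n` with `A_n`, so that the map
`H³(G, A_n) → H³(G, f⁻¹ A_n)` becomes multiplication by `f`. -/
theorem exists_mem_divClasses (hf : Function.Injective fun t : A => f • t)
    (h : ∀ t ∈ lowerSeries A n, ∃ s, t = f • s)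
    (c : groupCohomology (subRep A n) 3) (hc : f • c = 0) :
    ∃ x ∈ divClasses A n f, connecting A n x = c := by
  let B := A.subrepresentation (divSeries A n f) (divSeries_le_comap A n f)
  let e : TwistedHom (MonoidHom.id G) B (subRep A n) :=
    ⟨LinearMap.restrict (p := divSeries A n f) (q := lowerSeries A n) (f • LinearMap.id)
      fun t ht => ht, fun g x => Subtype.ext (map_nsmul (A.ρ g) f x.1).symm⟩
  have hdiv : ∀ t : lowerSeries A n, ∃ s : divSeries A n f, f • s.1 = t.1 := fun t => by
    obtain ⟨s, hs⟩ := h t.1 t.2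
    exact ⟨⟨s, show f • s ∈ lowerSeries A n from hs ▸ t.2⟩, hs.symm⟩
  let e' : lowerSeries A n ≃ₗ[k] divSeries A n f := (LinearEquiv.ofBijective e.toLin
    ⟨fun x y hxy => Subtype.ext (hf (congrArg Subtype.val hxy)), fun t =>
      (hdiv t).imp fun s hs => Subtype.ext hs⟩).symm
  let i : TwistedHom (MonoidHom.id G) (subRep A n) B := TwistedHom.ofHom (divSeq A n f).f
  let j : TwistedHom (MonoidHom.id G) (subRep A n) B :=
    ⟨e'.toLinearMap, fun g v => by
      obtain ⟨x, rfl⟩ := e'.symm.surjective v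
      change e' (((subRep A n).ρ g) (e.toLin x)) = _
      rw [← e.comm]
      change e' (e'.symm _) = B.ρ g (e' (e'.symm x))
      rw [e'.apply_symm_apply, e'.apply_symm_apply]
      rfl⟩
  have h0 : i.map 3 c = 0 := by
    rw [← TwistedHom.map_id (φ := ⟨LinearMap.id, fun _ _ => rfl⟩) (fun _ => rfl) 3 (i.map 3 c),
      ← TwistedHom.map_map e j _ rfl (fun v => (e'.apply_symm_apply v).symm),
      TwistedHom.map_map i e (TwistedHom.nsmul _ f) rfl (fun _ => rfl), TwistedHom.map_nsmul, hc,
      map_zero]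
  obtain ⟨y, hy⟩ := (ShortComplex.moduleCat_exact_iff _).1
    (groupCohomology.mapShortComplex₁_exact (divSeq_shortExact A n f) (i := 2) (j := 3) rfl) c h0
  exact ⟨_, ⟨y, rfl⟩, (connecting_map_divQuotSubtype A n f y).trans hy⟩

end DivClasses

/-! ### The canonical isomorphism -/

section Canonical

variable {k G : Type} [CommRing k] [Group G]

/-- Multiplication by `|G|` is injective on `A`, and `|G|⁻¹ A_n ≤ |G| A`. For a uniserial `p`-adic
module, this holds for all large `n`. -/
structure IsDeep (A : Rep.{0} k G) (n : ℕ) : Prop where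
  injective : Function.Injective fun t : A => Nat.card G • t
  exists_eq : ∀ t : A, Nat.card G • t ∈ lowerSeries A n → ∃ s, t = Nat.card G • s

namespace IsDeep

variable {A : Rep.{0} k G} {n : ℕ}

lemma exists_eq_of_mem (h : IsDeep A n) {t : A} (ht : t ∈ lowerSeries A n) :
    ∃ s, t = Nat.card G • s :=
  h.exists_eq t ((lowerSeries A n).smul_of_tower_mem _ ht)

variable [Finite G]

lemma reduction_injective (h : IsDeep A n) : Function.Injective (reduction A n) := by
  refine (injective_iff_map_eq_zero _).2 fun α hα => ?_
  obtain ⟨w, rfl⟩ := (ShortComplex.moduleCat_exact_iff _).1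
    (groupCohomology.mapShortComplex₂_exact (seriesSeq_shortExact A n) 2) α hα
  exact map_subtype_eq_zero A h.injective _ (lowerSeries_le_comap A n)
    (fun t ht => h.exists_eq_of_mem ht) 1 w

lemma exponent_dvd_card (A : Rep.{0} k G) (n : ℕ) :
    AddMonoid.exponent (groupCohomology (subRep A n) 3) ∣ Nat.card G :=
  AddMonoid.exponent_dvd_of_forall_nsmul_eq_zero fun c => card_nsmul_eq_zero _ 2 c

/-- The classes with values in `f⁻¹ A_n / A_n`, where `f` is the exponent of `H³(G, A_n)`, are
mapped onto `H³(G, A_n)`. -/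
lemma exists_mem_divClasses (h : IsDeep A n) (c : groupCohomology (subRep A n) 3) :
    ∃ x ∈ divClasses A n (AddMonoid.exponent (groupCohomology (subRep A n) 3)),
      connecting A n x = c := by
  obtain ⟨m, hm⟩ := exponent_dvd_card A n
  refine UniserialCohomology.exists_mem_divClasses A n _ (fun x y hxy => h.injective ?_)
    (fun t ht => ?_) c (AddMonoid.exponent_nsmul_eq_zero c)
  · change Nat.card G • x = Nat.card G • y
    rw [hm, mul_comm, mul_smul, mul_smul]
    exact congrArg (m • ·) hxy
  · obtain ⟨s, rfl⟩ := h.exists_eq_of_mem ht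
    exact ⟨m • s, by rw [hm, mul_smul]⟩

/-- The classes with values in `|G|⁻¹ A_n / A_n` are determined by their image in `H³(G, A_n)`. -/
lemma eq_of_mem_divClasses (h : IsDeep A n) {x y : groupCohomology (quotRep A n) 2}
    (hx : x ∈ divClasses A n (Nat.card G)) (hy : y ∈ divClasses A n (Nat.card G))
    (hxy : connecting A n x = connecting A n y) : x = y :=
  sub_eq_zero.1 (eq_zero_of_mem_divClasses A n h.injective h.exists_eq (sub_mem hx hy)
    (by rw [map_sub, hxy, sub_self]))

end IsDeep

lemma connecting_reduction (A : Rep.{0} k G) (n : ℕ) (α : groupCohomology A 2) :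
    connecting A n (reduction A n α) = 0 :=
  congrArg (fun F => F.hom α) (groupCohomology.mapShortComplex₃ (seriesSeq_shortExact A n)
    (i := 2) (j := 3) rfl).zero

lemma exists_reduction_eq (A : Rep.{0} k G) (n : ℕ) (x : groupCohomology (quotRep A n) 2)
    (hx : connecting A n x = 0) : ∃ α, reduction A n α = x :=
  (ShortComplex.moduleCat_exact_iff _).1 (groupCohomology.mapShortComplex₃_exact
    (seriesSeq_shortExact A n) (i := 2) (j := 3) rfl) x hx

namespace IsCanonical

variable {A : Rep.{0} k G} {n : ℕ} {Φ : groupCohomology A 2 × groupCohomology (subRep A n) 3 ≃+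
  groupCohomology (quotRep A n) 2}

lemma apply_eq (hΦ : IsCanonical A n Φ) (α β) : Φ (α, β) = reduction A n α + Φ (0, β) := by
  rw [← hΦ.map_left, ← map_add, Prod.mk_add_mk, add_zero, zero_add]

variable [Finite G]

lemma map_right_mem (hΦ : IsCanonical A n Φ) (β) : Φ (0, β) ∈ divClasses A n (Nat.card G) :=
  divClasses_mono A n (IsDeep.exponent_dvd_card A n)
    ((mem_divClasses A n _).2 (hΦ.map_right β))

lemma eq_map_right (hΦ : IsCanonical A n Φ) (h : IsDeep A n)
    {x : groupCohomology (quotRep A n) 2} (hx : x ∈ divClasses A n (Nat.card G)) :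
    x = Φ (0, connecting A n x) :=
  h.eq_of_mem_divClasses hx (hΦ.map_right_mem _) (hΦ.connecting_map _ _).symm

end IsCanonical

theorem IsDeep.existsUnique_isCanonical [Finite G] {A : Rep.{0} k G} {n : ℕ} (h : IsDeep A n) :
    ∃! Φ : groupCohomology A 2 × groupCohomology (subRep A n) 3 ≃+
      groupCohomology (quotRep A n) 2, IsCanonical A n Φ := by
  let C := divClasses A n (AddMonoid.exponent (groupCohomology (subRep A n) 3))
  have hC : C ≤ divClasses A n (Nat.card G) := divClasses_mono A n (exponent_dvd_card A n)
  let e : C ≃+ groupCohomology (subRep A n) 3 :=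
    AddEquiv.ofBijective ((connecting A n).comp C.subtype)
      ⟨fun x y hxy => Subtype.ext (h.eq_of_mem_divClasses (hC x.2) (hC y.2) hxy), fun c =>
        (h.exists_mem_divClasses c).elim fun x hx => ⟨⟨x, hx.1⟩, hx.2⟩⟩
  have he : ∀ c, connecting A n (e.symm c).1 = c := fun c => e.apply_symm_apply c
  let F := (reduction A n).coprod (C.subtype.comp e.symm.toAddMonoidHom)
  have hF : ∀ α β, F (α, β) = reduction A n α + (e.symm β).1 := fun _ _ => rfl
  have hFδ : ∀ α β, connecting A n (F (α, β)) = β := fun α β => by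
    rw [hF, map_add, connecting_reduction, he, zero_add]
  refine ⟨AddEquiv.ofBijective F ⟨?_, fun x => ?_⟩, ⟨fun α => ?_, hFδ, fun β => ?_⟩, ?_⟩
  · refine (injective_iff_map_eq_zero _).2 fun ⟨α, β⟩ hx => ?_
    obtain rfl : β = 0 := by rw [← hFδ α β, hx, map_zero]
    rw [hF, map_zero, ZeroMemClass.coe_zero, add_zero] at hx
    rw [h.reduction_injective (hx.trans (map_zero _).symm)]
    rfl
  · obtain ⟨α, hα⟩ := exists_reduction_eq A n (x - (e.symm (connecting A n x)).1)
      (by rw [map_sub, he, sub_self])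
    exact ⟨(α, connecting A n x), by rw [hF, hα, sub_add_cancel]⟩
  · exact (hF α 0).trans (by rw [map_zero, ZeroMemClass.coe_zero, add_zero])
  · obtain ⟨z, hz, hz'⟩ := (mem_divClasses A n _).1 (e.symm β).2
    refine ⟨z, hz.trans ?_, hz'⟩
    exact ((hF 0 β).trans (by rw [map_zero, zero_add])).symm
  · intro Ψ hΨ
    refine AddEquiv.ext fun ⟨α, β⟩ => ?_
    refine (hΨ.apply_eq α β).trans (Eq.trans ?_ (hF α β).symm)
    congr 1
    exact h.eq_of_mem_divClasses (hΨ.map_right_mem β) (hC (e.symm β).2)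
      ((hΨ.connecting_map _ _).trans (he β).symm)

end Canonical

/-! ### Compatible pairs in terms of the canonical isomorphism -/

section Lift

variable {k G : Type} [CommRing k] [Group G] {A : Rep.{0} k G}

namespace TwistedHom

variable {f : G →* G} (hf : Function.Surjective f) (E : TwistedHom f A A)

include hf in
lemma apply_mem_lowerSeries (n : ℕ) {t : A} (ht : t ∈ lowerSeries A n) :
    E.toLin t ∈ lowerSeries A n := by
  induction n generalizing t with
  | zero => trivial
  | succ n ih =>
    suffices h : lowerSeries A (n + 1) ≤ (lowerSeries A (n + 1)).comap E.toLin from h ht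
    refine Submodule.span_le.2 ?_
    rintro _ ⟨v, hv, g, rfl⟩
    obtain ⟨g, rfl⟩ := hf g
    refine Submodule.subset_span ⟨E.toLin v, ih hv, g, ?_⟩
    rw [map_sub, E.comm]

/-- The restriction of an equivariant endomorphism to `A_n`. -/
def sub (n : ℕ) : TwistedHom f (subRep A n) (subRep A n) :=
  ⟨E.toLin.restrict fun _ ht => E.apply_mem_lowerSeries hf n ht,
    fun g v => Subtype.ext (E.comm g v.1)⟩

/-- The endomorphism of `A / A_n` induced by an equivariant endomorphism. -/
def quot (n : ℕ) : TwistedHom f (quotRep A n) (quotRep A n) :=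
  ⟨(lowerSeries A n).mapQ _ E.toLin fun _ ht => E.apply_mem_lowerSeries hf n ht, fun g v => by
    obtain ⟨v, rfl⟩ := (lowerSeries A n).mkQ_surjective v
    exact congrArg (lowerSeries A n).mkQ (E.comm g v)⟩

end TwistedHom

/-- A compatible pair `c` of `A / A_n` with first component `β` is induced by `E + φ`, where `E` is
an endomorphism of `A` that is equivariant along `β`, while `φ` has values in `|G|⁻¹ A_n` and is
equivariant along `β` modulo `A_n`. -/
structure IsLift {n : ℕ} (c : Comp (quotRep A n)) {β : MulAut G}
    (E : TwistedHom β⁻¹.toMonoidHom A A) (φ : A →ₗ[k] A) : Prop where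
  fst_eq : c.1.1 = β
  snd_mk : ∀ v, c.1.2 ((lowerSeries A n).mkQ v) = (lowerSeries A n).mkQ (E.toLin v + φ v)
  nsmul_mem : ∀ v, Nat.card G • φ v ∈ lowerSeries A n
  comm : ∀ g v, φ (A.ρ g v) - A.ρ (β g) (φ v) ∈ lowerSeries A n

/-- The second component of a compatible pair, as a twisted homomorphism. -/
noncomputable def compHom (V : Rep.{0} k G) (c : Comp V) :
    TwistedHom (c.1.1⁻¹ : MulAut G).toMonoidHom V V :=
  ⟨c.1.2.toLinearMap, fun g v => by
    have := c.2 (c.1.1⁻¹ g) v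
    rwa [MulAut.apply_inv_self] at this⟩

lemma orbits_mk_eq_iff {V : Rep.{0} k G} {x y : groupCohomology V 2} :
    (Quotient.mk'' x : Orbits V) = Quotient.mk'' y ↔ ∃ c : Comp V, (compHom V c).map 2 y = x :=
  Quotient.eq''.trans MulAction.orbitRel_apply

namespace IsLift

variable {n : ℕ} {c : Comp (quotRep A n)} {β : MulAut G} {E : TwistedHom β⁻¹.toMonoidHom A A}
  {φ : A →ₗ[k] A}

/-- The map `A → A / A_n` induced by `φ`. -/
noncomputable def error (h : IsLift c E φ) : TwistedHom β⁻¹.toMonoidHom A (quotRep A n) :=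
  ⟨(lowerSeries A n).mkQ ∘ₗ φ, fun g v => (Submodule.Quotient.eq _).2 (by
    have := h.comm (β⁻¹ g) v
    rwa [MulAut.apply_inv_self] at this)⟩

/-- As `φ` has values in `|G|⁻¹ A_n`, it maps `H²(G, A)` to the canonical complement. -/
lemma map_error_mem (h : IsLift c E φ) (α : groupCohomology A 2) :
    h.error.map 2 α ∈ divClasses A n (Nat.card G) := by
  induction α using groupCohomology.H2_induction_on with | h z => ?_
  exact (mem_divClasses A n _).2 ⟨h.error.mapCocycles z, (TwistedHom.map_H2π _ z).symm,
    fun g j => ⟨_, rfl, h.nsmul_mem _⟩⟩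

lemma map_reduction (h : IsLift c E φ) (α : groupCohomology A 2) :
    (compHom _ c).map 2 (reduction A n α) = reduction A n (E.map 2 α) + h.error.map 2 α := by
  obtain rfl := h.fst_eq
  let π := TwistedHom.ofHom (seriesSeq A n).g
  let χ : TwistedHom (c.1.1⁻¹ : MulAut G).toMonoidHom A (quotRep A n) :=
    ⟨(lowerSeries A n).mkQ ∘ₗ E.toLin, fun g v => congrArg (lowerSeries A n).mkQ (E.comm g v)⟩
  let ψ : TwistedHom (c.1.1⁻¹ : MulAut G).toMonoidHom A (quotRep A n) :=
    ⟨c.1.2.toLinearMap ∘ₗ (lowerSeries A n).mkQ, fun g v => (compHom _ c).comm g (π.toLin v)⟩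
  have h1 : (compHom _ c).map 2 (reduction A n α) = ψ.map 2 α :=
    TwistedHom.map_map π (compHom _ c) ψ rfl (fun _ => rfl) 2 α
  have h2 : reduction A n (E.map 2 α) = χ.map 2 α :=
    TwistedHom.map_map E π χ rfl (fun _ => rfl) 2 α
  rw [h1, h2]
  exact TwistedHom.map_add (fun v => (h.snd_mk v).trans (map_add _ _ _)) 2 α

/-- On `|G|⁻¹ A_n / A_n`, the map `φ` vanishes, since `|G|⁻¹ A_n ≤ |G| A`. -/
lemma map_of_mem (h : IsLift c E φ) (hn : IsDeep A n) {x : groupCohomology (quotRep A n) 2}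
    (hx : x ∈ divClasses A n (Nat.card G)) :
    (compHom _ c).map 2 x = (E.quot β⁻¹.surjective n).map 2 x := by
  obtain rfl := h.fst_eq
  obtain ⟨z, rfl, hz⟩ := (mem_divClasses A n _).1 hx
  refine (TwistedHom.map_H2π (compHom _ c) z).trans
    (Eq.trans ?_ (TwistedHom.map_H2π (E.quot (MulEquiv.surjective _) n) z).symm)
  refine congrArg _ (groupCohomology.cocycles₂_ext fun g j => ?_)
  rw [TwistedHom.mapCocycles_apply, TwistedHom.mapCocycles_apply]
  obtain ⟨t, ht, ht'⟩ := hz (c.1.1⁻¹ g) (c.1.1⁻¹ j)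
  change c.1.2 (z (c.1.1⁻¹ g, c.1.1⁻¹ j)) = (E.quot _ n).toLin (z (c.1.1⁻¹ g, c.1.1⁻¹ j))
  rw [ht]
  refine (h.snd_mk t).trans ((Submodule.Quotient.eq _).2 ?_)
  obtain ⟨s, rfl⟩ := hn.exists_eq t ht'
  rw [add_sub_cancel_left, map_nsmul]
  exact h.nsmul_mem s

lemma map_quot_mem {x : groupCohomology (quotRep A n) 2}
    (hx : x ∈ divClasses A n (Nat.card G)) :
    (E.quot β⁻¹.surjective n).map 2 x ∈ divClasses A n (Nat.card G) := by
  obtain ⟨z, rfl, hz⟩ := (mem_divClasses A n _).1 hx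
  refine (mem_divClasses A n _).2 ⟨(E.quot β⁻¹.surjective n).mapCocycles z,
    (TwistedHom.map_H2π _ z).symm, fun g j => ?_⟩
  obtain ⟨t, ht, ht'⟩ := hz (β⁻¹.toMonoidHom g) (β⁻¹.toMonoidHom j)
  refine ⟨E.toLin t, ?_, ?_⟩
  · rw [TwistedHom.mapCocycles_apply, ht]
    rfl
  · rw [← map_nsmul]
    exact E.apply_mem_lowerSeries β⁻¹.surjective n ht'

lemma connecting_map_quot (x : groupCohomology (quotRep A n) 2) :
    connecting A n ((E.quot β⁻¹.surjective n).map 2 x) =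
      (E.sub β⁻¹.surjective n).map 3 (connecting A n x) :=
  (TwistedHom.map_δ (seriesSeq_shortExact A n) (seriesSeq_shortExact A n)
    (E.sub β⁻¹.surjective n) E (E.quot β⁻¹.surjective n)
    (fun _ => rfl) (fun _ => rfl) 2 3 rfl x).symm

variable [Finite G] {Φ : groupCohomology A 2 × groupCohomology (subRep A n) 3 ≃+
  groupCohomology (quotRep A n) 2}

/-- The action of a compatible pair in terms of the canonical decomposition: it is triangular, with
`E` on the diagonal, and the off-diagonal term depends only on `φ`. -/
theorem map_apply (h : IsLift c E φ) (hn : IsDeep A n) (hΦ : IsCanonical A n Φ) (α γ) :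
    (compHom _ c).map 2 (Φ (α, γ)) = Φ (E.map 2 α,
      (E.sub β⁻¹.surjective n).map 3 γ + connecting A n (h.error.map 2 α)) := by
  have hγ := hΦ.map_right_mem γ
  have h1 : (compHom _ c).map 2 (Φ (0, γ)) = Φ (0, (E.sub β⁻¹.surjective n).map 3 γ) := by
    rw [h.map_of_mem hn hγ, hΦ.eq_map_right hn (map_quot_mem hγ), connecting_map_quot,
      hΦ.connecting_map]
  rw [hΦ.apply_eq α, map_add, h1, h.map_reduction, hΦ.eq_map_right hn (h.map_error_mem α),
    hΦ.apply_eq (E.map 2 α), hΦ.connecting_map, add_assoc, ← map_add, Prod.mk_add_mk, add_zero,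
    add_comm (connecting A n _)]

end IsLift

end Lift

/-! ### Existence of lifts -/

section ExistsLift

variable {k G : Type} [CommRing k] [Group G] {A : Rep.{0} k G} {n : ℕ}

/-- If the second component of a compatible pair lifts to a linear map `e`, then the average of `e`
over the group is an equivariant map that is divisible by `|G|` and whose quotient by `|G|` agrees
with `e` modulo `|G|⁻¹ A_n`. -/
theorem exists_isLift [Finite G] (hn : IsDeep A n) (c : Comp (quotRep A n)) (e : A →ₗ[k] A)
    (he : ∀ v, (lowerSeries A n).mkQ (e v) = c.1.2 ((lowerSeries A n).mkQ v)) :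
    ∃ (E : TwistedHom (c.1.1⁻¹ : MulAut G).toMonoidHom A A) (φ : A →ₗ[k] A), IsLift c E φ := by
  have := Fintype.ofFinite G
  let π := (lowerSeries A n).mkQ
  let β : MulAut G := c.1.1
  -- `S` is equivariant along `β`, and congruent to `|G| e` modulo `A_n`, hence divisible by `|G|`.
  let S : A →ₗ[k] A := ∑ g : G, A.ρ (β g)⁻¹ ∘ₗ e ∘ₗ A.ρ g
  have hS : ∀ v, S v = ∑ g : G, A.ρ (β g)⁻¹ (e (A.ρ g v)) := fun v => by
    simp only [S, LinearMap.sum_apply, LinearMap.comp_apply]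
  have hmul : ∀ a b v, A.ρ a (A.ρ b v) = A.ρ (a * b) v := fun a b v => by
    rw [map_mul]
    rfl
  have hcomm : ∀ g v, S (A.ρ g v) = A.ρ (β g) (S v) := fun g v => by
    rw [hS, hS, map_sum]
    refine Fintype.sum_equiv (Equiv.mulRight g) _ _ fun h => ?_
    change _ = A.ρ (β g) (A.ρ (β (h * g))⁻¹ (e (A.ρ (h * g) v)))
    rw [hmul, hmul, map_mul β, mul_inv_rev, mul_inv_cancel_left]
  have hρ : ∀ g v, π (A.ρ g v) = (quotRep A n).ρ g (π v) := fun _ _ => rfl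
  have hπ : ∀ v, π (S v) = Nat.card G • π (e v) := fun v => by
    rw [hS, map_sum, Nat.card_eq_fintype_card, ← Finset.card_univ, ← Finset.sum_const]
    refine Finset.sum_congr rfl fun g _ => ?_
    rw [hρ, he, he, hρ, c.2, ← Module.End.mul_apply, ← map_mul, inv_mul_cancel, map_one]
    rfl
  obtain ⟨E, hE⟩ := exists_nsmul_eq hn.injective S fun v => by
    have h1 : S v - Nat.card G • e v ∈ lowerSeries A n :=
      (Submodule.Quotient.eq _).1 ((hπ v).trans (map_nsmul π _ _).symm)
    obtain ⟨s, hs⟩ := hn.exists_eq_of_mem h1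
    exact ⟨s + e v, by rw [smul_add, ← hs, sub_add_cancel]⟩
  have hEcomm : ∀ g v, E (A.ρ g v) = A.ρ (β g) (E v) := fun g v => hn.injective (by
    change Nat.card G • _ = Nat.card G • _
    rw [← hE, hcomm, hE, map_nsmul])
  refine ⟨⟨E, fun g v => ?_⟩, e - E, rfl, fun v => ?_, fun v => ?_, fun g v => ?_⟩
  · refine (hEcomm _ v).trans ?_
    exact congrArg (fun h => A.ρ h (E v)) (MulAut.apply_inv_self _ β g)
  · rw [LinearMap.sub_apply, add_sub_cancel]
    exact (he v).symm
  · refine (Submodule.Quotient.mk_eq_zero _).1 ?_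
    change π (Nat.card G • (e v - E v)) = 0
    rw [smul_sub, ← hE, map_sub, hπ, map_nsmul, sub_self]
  · refine (Submodule.Quotient.mk_eq_zero _).1 ?_
    change π (e (A.ρ g v) - E (A.ρ g v) - A.ρ (β g) (e v - E v)) = 0
    rw [hEcomm, map_sub (A.ρ _), sub_sub_sub_cancel_right, map_sub, hρ, he, he, hρ, c.2, sub_self]

/-- A map `E + φ` that satisfies the conditions in `IsLift` and is surjective modulo `A_n` induces
a compatible pair of the finite module `A / A_n`. -/
theorem exists_comp_isLift (hn : IsDeep A n) [Finite (A ⧸ lowerSeries A n)] {β : MulAut G}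
    (E : TwistedHom β⁻¹.toMonoidHom A A) (φ : A →ₗ[k] A)
    (hφ : ∀ v, Nat.card G • φ v ∈ lowerSeries A n)
    (hφβ : ∀ g v, φ (A.ρ g v) - A.ρ (β g) (φ v) ∈ lowerSeries A n)
    (hs : ∀ v, ∃ w, v - (E.toLin w + φ w) ∈ lowerSeries A n) :
    ∃ c : Comp (quotRep A n), IsLift c E φ := by
  let ε : (A ⧸ lowerSeries A n) →ₗ[k] (A ⧸ lowerSeries A n) :=
    (lowerSeries A n).mapQ _ (E.toLin + φ) fun t ht => by
      refine add_mem (S := Submodule k A) (E.apply_mem_lowerSeries β⁻¹.surjective n ht) ?_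
      obtain ⟨s, rfl⟩ := hn.exists_eq_of_mem ht
      rw [map_nsmul]
      exact hφ s
  have hε : Function.Surjective ε := fun v => by
    obtain ⟨v, rfl⟩ := (lowerSeries A n).mkQ_surjective v
    obtain ⟨w, hw⟩ := hs v
    exact ⟨(lowerSeries A n).mkQ w, ((Submodule.Quotient.eq _).2 hw).symm⟩
  refine ⟨⟨(β, LinearEquiv.ofBijective ε ⟨Finite.injective_iff_surjective.2 hε, hε⟩),
    fun g v => ?_⟩, rfl, fun v => rfl, hφ, hφβ⟩
  obtain ⟨v, rfl⟩ := (lowerSeries A n).mkQ_surjective v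
  refine (Submodule.Quotient.eq _).2 ?_
  have hE : E.toLin (A.ρ g v) = A.ρ (β g) (E.toLin v) := by
    have := E.comm (β g) v
    rwa [show β⁻¹.toMonoidHom (β g) = g from MulAut.inv_apply_self _ β g] at this
  change E.toLin (A.ρ g v) + φ (A.ρ g v) - A.ρ (β g) (E.toLin v + φ v) ∈ lowerSeries A n
  rw [hE, map_add, add_sub_add_left_eq_sub]
  exact hφβ g v

/-- A map that is surjective modulo `p` is surjective modulo every power of `p`. -/
lemma exists_eq_add_pow_nsmul {M : Type} [AddCommGroup M] (l : M →+ M) {p : ℕ}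
    (h : ∀ v, ∃ w s, v = l w + p • s) (j : ℕ) (v : M) : ∃ w s, v = l w + p ^ j • s := by
  induction j generalizing v with
  | zero => exact ⟨0, v, by simp⟩
  | succ j ih =>
    obtain ⟨w, s, rfl⟩ := ih v
    obtain ⟨w', s', rfl⟩ := h s
    exact ⟨w + p ^ j • w', s', by rw [map_add, map_nsmul, smul_add, pow_succ, mul_smul, add_assoc]⟩

end ExistsLift

/-! ### Uniserial `p`-adic modules -/

section Uniserial

variable {p : ℕ} {R T : Type} [Group R] [AddCommGroup T] [DistribMulAction R T]

lemma nsmul_mem_lowerSeries_succ (hT : IsUniserial p (asRep R T)) {n : ℕ} {t : T}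
    (ht : t ∈ lowerSeries (asRep R T) n) : p • t ∈ lowerSeries (asRep R T) (n + 1) := by
  by_cases h : lowerSeries (asRep R T) n = ⊥
  · rw [h] at ht
    obtain rfl : t = 0 := ht
    rw [smul_zero]
    exact zero_mem _
  · rw [← hT n h]
    exact AddSubgroup.nsmul_index_mem
      ((lowerSeries (asRep R T) (n + 1)).toAddSubgroup.addSubgroupOf
        (lowerSeries (asRep R T) n).toAddSubgroup) ⟨t, ht⟩

lemma pow_nsmul_mem_lowerSeries (hT : IsUniserial p (asRep R T)) (n : ℕ) (t : T) :
    p ^ n • t ∈ lowerSeries (asRep R T) n := by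
  induction n with
  | zero => trivial
  | succ n ih =>
    rw [pow_succ', mul_smul]
    exact nsmul_mem_lowerSeries_succ hT ih

variable [Fact p.Prime]

lemma finite_quotient_lowerSeries (hT : IsUniserial p (asRep R T)) (n : ℕ) :
    Finite (T ⧸ lowerSeries (asRep R T) n) := by
  suffices h : (lowerSeries (asRep R T) n).toAddSubgroup.index ≠ 0 by
    have : (lowerSeries (asRep R T) n).toAddSubgroup.FiniteIndex := ⟨h⟩
    exact AddSubgroup.finite_quotient_of_finiteIndex
  induction n with
  | zero =>
    change (⊤ : AddSubgroup T).index ≠ 0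
    simp
  | succ n ih =>
    have hle : (lowerSeries (asRep R T) (n + 1)).toAddSubgroup ≤
      (lowerSeries (asRep R T) n).toAddSubgroup := lowerSeries_succ_le (asRep R T) n
    rw [← AddSubgroup.relIndex_mul_index hle]
    refine mul_ne_zero ?_ ih
    by_cases h : lowerSeries (asRep R T) n = ⊥
    · have h1 : (lowerSeries (asRep R T) n).toAddSubgroup ≤
          (lowerSeries (asRep R T) (n + 1)).toAddSubgroup := by
        rw [h]
        exact bot_le
      rw [AddSubgroup.relIndex_eq_one.2 h1]
      exact one_ne_zero
    · rw [hT n h]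
      exact (Fact.out : p.Prime).ne_zero

lemma pow_nsmul_injective (p : ℕ) [Fact p.Prime] (T : Type) [AddCommGroup T] [Module ℤ_[p] T]
    [Module.Free ℤ_[p] T] (j : ℕ) : Function.Injective fun t : T => p ^ j • t := by
  induction j with
  | zero => exact fun x y hxy => by simpa using hxy
  | succ j ih =>
    intro x y hxy
    refine ih (nsmul_injective p T ?_)
    change p • p ^ j • x = p • p ^ j • y
    simpa only [pow_succ', mul_smul] using hxy

/-- Additive maps that agree on a basis over `ℤ_p` agree modulo any subgroup that contains a
multiple `p^j T`, since natural numbers are dense in `ℤ_p`. -/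
lemma addMonoidHom_eq_of_basis (p : ℕ) [Fact p.Prime] [Module ℤ_[p] T]
    {M : Type} [AddCommGroup M] {j : ℕ} (hM : ∀ m : M, p ^ j • m = 0)
    {ι : Type} [Finite ι] (b : Module.Basis ι ℤ_[p] T) (D D' : T →+ M)
    (h : ∀ i, D (b i) = D' (b i)) : D = D' := by
  have := Fintype.ofFinite ι
  have key : ∀ (F : T →+ M) (a : ℤ_[p]) (t : T), F (a • t) = a.appr j • F t := fun F a t => by
    obtain ⟨c, hc⟩ := Ideal.mem_span_singleton.1 (PadicInt.appr_spec j a)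
    have hat : a • t = p ^ j • c • t + a.appr j • t := by
      conv_lhs => rw [sub_eq_iff_eq_add.1 hc]
      rw [add_smul, mul_smul, Nat.cast_smul_eq_nsmul, ← Nat.cast_pow, Nat.cast_smul_eq_nsmul]
    rw [hat, map_add, map_nsmul, map_nsmul, hM, zero_add]
  ext t
  rw [← b.sum_repr t, map_sum, map_sum]
  exact Finset.sum_congr rfl fun i _ => by rw [key, key, h]

/-- Every additive endomorphism of `T / T_n` lifts to `T`: the `ℤ_p`-linear map that sends each
element of a basis to a lift of its image is such a lift. -/
lemma exists_lift (p : ℕ) [Fact p.Prime] [Module ℤ_[p] T] [Module.Free ℤ_[p] T]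
    [Module.Finite ℤ_[p] T] (hT : IsUniserial p (asRep R T)) (n : ℕ)
    (ε : (T ⧸ lowerSeries (asRep R T) n) →+ (T ⧸ lowerSeries (asRep R T) n)) :
    ∃ e : T →+ T, ∀ v, (lowerSeries (asRep R T) n).mkQ (e v) =
      ε ((lowerSeries (asRep R T) n).mkQ v) := by
  let π := (lowerSeries (asRep R T) n).mkQ.toAddMonoidHom
  let b := Module.finBasis ℤ_[p] T
  choose u hu using fun i => (lowerSeries (asRep R T) n).mkQ_surjective (ε (π (b i)))
  refine ⟨(b.constr ℤ u).toAddMonoidHom, DFunLike.congr_fun (addMonoidHom_eq_of_basis p (j := n)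
    (fun m => ?_) b (π.comp (b.constr ℤ u).toAddMonoidHom) (ε.comp π) fun i => ?_)⟩
  · obtain ⟨t, rfl⟩ := (lowerSeries (asRep R T) n).mkQ_surjective m
    rw [← map_nsmul]
    exact (Submodule.Quotient.mk_eq_zero _).2 (pow_nsmul_mem_lowerSeries hT n t)
  · change (lowerSeries (asRep R T) n).mkQ (b.constr ℤ u (b i)) = _
    rw [b.constr_basis, hu]
    rfl

variable [Module ℤ_[p] T] [Module.Free ℤ_[p] T] [Module.Finite ℤ_[p] T]

lemma mem_lowerSeries_add_finrank (hR : IsPGroup p R) (hT : IsUniserial p (asRep R T)) {n : ℕ}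
    {t : T} : t ∈ lowerSeries (asRep R T) (n + Module.finrank ℤ_[p] T) ↔
      ∃ s ∈ lowerSeries (asRep R T) n, p • s = t := by
  change t ∈ (lowerSeries (asRep R T) (n + Module.finrank ℤ_[p] T)).toAddSubgroup ↔ _
  rw [lowerSeries_add_finrank hR hT]
  rfl

lemma nsmul_mem_lowerSeries_add_finrank (hR : IsPGroup p R) (hT : IsUniserial p (asRep R T))
    {n : ℕ} {t : T} : p • t ∈ lowerSeries (asRep R T) (n + Module.finrank ℤ_[p] T) ↔
      t ∈ lowerSeries (asRep R T) n := by
  rw [mem_lowerSeries_add_finrank hR hT]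
  exact ⟨fun ⟨s, hs, hst⟩ => nsmul_injective p T hst ▸ hs, fun ht => ⟨t, ht, rfl⟩⟩

lemma exists_pow_nsmul_eq (hR : IsPGroup p R) (hT : IsUniserial p (asRep R T)) {n j : ℕ}
    (hn : j * Module.finrank ℤ_[p] T ≤ n) {t : T} (ht : t ∈ lowerSeries (asRep R T) n) :
    ∃ s, t = p ^ j • s := by
  induction j generalizing n t with
  | zero => exact ⟨t, by simp⟩
  | succ j ih =>
    rw [add_mul, one_mul] at hn
    obtain ⟨m, rfl⟩ := Nat.exists_eq_add_of_le' ((Nat.le_add_left _ _).trans hn)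
    obtain ⟨s, hs, rfl⟩ := (mem_lowerSeries_add_finrank hR hT).1 ht
    obtain ⟨s', rfl⟩ := ih (Nat.le_of_add_le_add_right hn) hs
    exact ⟨s', by rw [pow_succ', mul_smul]⟩

end Uniserial

/-! ### Passage from `T_n` to `T_{n+d}` -/

lemma exists_orbits_equiv {k G : Type} [CommRing k] [Group G] {V W : Rep.{0} k G}
    (F : groupCohomology V 2 ≃+ groupCohomology W 2)
    (h₁ : ∀ c : Comp V, ∃ c' : Comp W, ∀ x, F ((compHom V c).map 2 x) = (compHom W c').map 2 (F x))
    (h₂ : ∀ c' : Comp W, ∃ c : Comp V, ∀ x,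
      F ((compHom V c).map 2 x) = (compHom W c').map 2 (F x)) :
    ∃ e : Orbits V ≃ Orbits W, ∀ x, e (Quotient.mk'' x) = Quotient.mk'' (F x) := by
  refine ⟨Quotient.congr F.toEquiv fun x y => ?_, fun x => rfl⟩
  refine Quotient.eq''.symm.trans (orbits_mk_eq_iff.trans (Iff.trans ?_
    (orbits_mk_eq_iff.symm.trans Quotient.eq'')))
  constructor
  · rintro ⟨c, rfl⟩
    obtain ⟨c', hc'⟩ := h₁ c
    exact ⟨c', (hc' y).symm⟩
  · rintro ⟨c', hc'⟩
    obtain ⟨c, hc⟩ := h₂ c'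
    exact ⟨c, F.injective ((hc y).trans hc')⟩

section Step

variable {p : ℕ} {R T : Type} [Group R] [AddCommGroup T] [DistribMulAction R T]

variable {n : ℕ} {β : MulAut R}
  {E : TwistedHom β⁻¹.toMonoidHom (asRep R T) (asRep R T)} {φ : T →ₗ[ℤ] T}

/-- The equivariant part of a lift is surjective modulo `p`. -/
lemma IsLift.exists_eq_add_nsmul
    (hn : ∀ t : T, Nat.card R • t ∈ lowerSeries (asRep R T) n → ∃ s, t = p • Nat.card R • s)
    {c : Comp (quotRep (asRep R T) n)} (h : IsLift c E φ) (v : T) :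
    ∃ (w : T) (s : T), v = E.toLin w + p • s := by
  obtain ⟨w, hw⟩ := (lowerSeries (asRep R T) n).mkQ_surjective
    (c.1.2.symm ((lowerSeries (asRep R T) n).mkQ v))
  have h1 : v - (E.toLin w + φ w) ∈ lowerSeries (asRep R T) n := by
    refine (Submodule.Quotient.eq _).1 (Eq.trans ?_ (h.snd_mk w))
    rw [hw]
    exact (c.1.2.apply_symm_apply _).symm
  obtain ⟨s, hs⟩ := hn _ ((lowerSeries (asRep R T) n).smul_of_tower_mem (Nat.card R) h1)
  obtain ⟨s', hs'⟩ := hn _ (h.nsmul_mem w)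
  refine ⟨w, Nat.card R • s + Nat.card R • s', ?_⟩
  rw [smul_add, ← hs, ← hs']
  abel

variable [Fact p.Prime]

/-- As `φ` has values in `p T`, the map `E + φ` is surjective modulo `p`, hence modulo `T_n`, if
`E` is surjective modulo `p`. -/
lemma exists_comp_isLift_of_surjective_mod
    (hT : IsUniserial p (asRep R T)) (hd : IsDeep (asRep R T) n)
    (hn : ∀ t : T, Nat.card R • t ∈ lowerSeries (asRep R T) n → ∃ s, t = p • Nat.card R • s)
    (hE : ∀ v : T, ∃ (w : T) (s : T), v = E.toLin w + p • s)
    (hφ : ∀ v, Nat.card R • φ v ∈ lowerSeries (asRep R T) n)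
    (hφβ : ∀ (g : R) (v : T), φ (g • v) - β g • φ v ∈ lowerSeries (asRep R T) n) :
    ∃ c : Comp (quotRep (asRep R T) n), IsLift c E φ := by
  have : Finite (asRep R T ⧸ lowerSeries (asRep R T) n) := finite_quotient_lowerSeries hT n
  refine exists_comp_isLift hd E φ hφ hφβ fun v => ?_
  obtain ⟨w, s, hws⟩ := exists_eq_add_pow_nsmul (M := T) (p := p) (E.toLin + φ).toAddMonoidHom
    (fun v => by
      obtain ⟨w, s, rfl⟩ := hE v
      obtain ⟨s', hs'⟩ := hn _ (hφ w)
      refine ⟨w, s - Nat.card R • s', ?_⟩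
      change _ = E.toLin w + φ w + _
      rw [smul_sub, ← hs']
      abel) n v
  refine ⟨w, ?_⟩
  have h1 : v - (E.toLin w + φ w) = p ^ n • s := sub_eq_iff_eq_add'.2 hws
  rw [h1]
  exact pow_nsmul_mem_lowerSeries hT n s

variable [Module ℤ_[p] T] [Module.Free ℤ_[p] T]

lemma isDeep_of_exists_eq [Finite R] (hR : IsPGroup p R) {n : ℕ}
    (hn : ∀ t : T, Nat.card R • t ∈ lowerSeries (asRep R T) n → ∃ s, t = p • Nat.card R • s) :
    IsDeep (asRep R T) n where
  injective := by
    obtain ⟨r, hr⟩ := IsPGroup.iff_card.1 hR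
    rw [hr]
    exact pow_nsmul_injective p T r
  exists_eq t ht := by
    obtain ⟨s, rfl⟩ := hn t ht
    exact ⟨p • s, smul_comm _ _ _⟩

variable [Module.Finite ℤ_[p] T]

/-- From `T_n ≤ p^(2r+1) T`, where `|R| = p^r`, one gets `|R|⁻¹ T_n ≤ p^(r+1) T`. The factor `p` is
what makes the correction terms in lifts of compatible pairs vanish modulo `p`. -/
lemma eventually_exists_eq [Finite R] (hR : IsPGroup p R) (hT : IsUniserial p (asRep R T)) :
    ∃ N, ∀ n ≥ N, ∀ t : T, Nat.card R • t ∈ lowerSeries (asRep R T) n →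
      ∃ s, t = p • Nat.card R • s := by
  obtain ⟨r, hr⟩ := IsPGroup.iff_card.1 hR
  refine ⟨(r + (r + 1)) * Module.finrank ℤ_[p] T, fun n hn t ht => ?_⟩
  obtain ⟨s, hs⟩ := exists_pow_nsmul_eq hR hT hn ht
  refine ⟨s, pow_nsmul_injective p T r ?_⟩
  rw [hr, pow_add, mul_smul, pow_succ', mul_smul] at hs
  rw [hr]
  exact hs

variable (hR : IsPGroup p R) (hT : IsUniserial p (asRep R T))

/-- Multiplication by `p`, as a map `T / T_n → T / T_{n+d}`. -/
noncomputable def mulPQuot (n : ℕ) : TwistedHom (MonoidHom.id R) (quotRep (asRep R T) n)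
    (quotRep (asRep R T) (n + Module.finrank ℤ_[p] T)) :=
  ⟨(lowerSeries (asRep R T) n).mapQ _ (p • LinearMap.id) fun _ ht =>
    (nsmul_mem_lowerSeries_add_finrank hR hT).2 ht, fun g v => by
    obtain ⟨v, rfl⟩ := (lowerSeries (asRep R T) n).mkQ_surjective v
    exact congrArg (lowerSeries (asRep R T) (n + Module.finrank ℤ_[p] T)).mkQ
      (map_nsmul ((asRep R T).ρ g) p v).symm⟩

lemma mu_connecting (x : groupCohomology (quotRep (asRep R T) n) 2) :
    mu hR hT n (connecting (asRep R T) n x) =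
      connecting (asRep R T) (n + Module.finrank ℤ_[p] T) ((mulPQuot hR hT n).map 2 x) :=
  TwistedHom.map_δ (seriesSeq_shortExact (asRep R T) n)
    (seriesSeq_shortExact (asRep R T) (n + Module.finrank ℤ_[p] T))
    (TwistedHom.ofHom (mulP hR hT n).hom) (TwistedHom.nsmul (asRep R T) p) (mulPQuot hR hT n)
    (fun v => (natCast_zsmul v.1 p).symm) (fun _ => rfl) 2 3 rfl x

lemma mu_map_sub (x : groupCohomology (subRep (asRep R T) n) 3) :
    mu hR hT n ((E.sub β⁻¹.surjective n).map 3 x) =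
      (E.sub β⁻¹.surjective (n + Module.finrank ℤ_[p] T)).map 3 (mu hR hT n x) := by
  let m := TwistedHom.ofHom (mulP hR hT n).hom
  let χ : TwistedHom β⁻¹.toMonoidHom (subRep (asRep R T) n)
      (subRep (asRep R T) (n + Module.finrank ℤ_[p] T)) :=
    ⟨m.toLin ∘ₗ (E.sub β⁻¹.surjective n).toLin, fun g v =>
      (congrArg m.toLin ((E.sub β⁻¹.surjective n).comm g v)).trans (m.comm g _)⟩
  exact (TwistedHom.map_map (E.sub β⁻¹.surjective n) m χ rfl (fun _ => rfl) 3 x).trans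
    (TwistedHom.map_map m (E.sub β⁻¹.surjective _) χ rfl
      (fun v => Subtype.ext (map_zsmul E.toLin (p : ℤ) v.1).symm) 3 x).symm

variable {Φ : groupCohomology (asRep R T) 2 × groupCohomology (subRep (asRep R T) n) 3 ≃+
    groupCohomology (quotRep (asRep R T) n) 2}
  {Φ' : groupCohomology (asRep R T) 2 ×
      groupCohomology (subRep (asRep R T) (n + Module.finrank ℤ_[p] T)) 3 ≃+
    groupCohomology (quotRep (asRep R T) (n + Module.finrank ℤ_[p] T)) 2}

/-- Pairs induced by `E + φ` on `T / T_n` and by `E + p φ` on `T / T_{n+d}` correspond to each other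
under `id ⊕ μ`. -/
theorem idPlusMu_map [Finite R] (hd : IsDeep (asRep R T) n)
    (hd' : IsDeep (asRep R T) (n + Module.finrank ℤ_[p] T))
    (hΦ : IsCanonical (asRep R T) n Φ)
    (hΦ' : IsCanonical (asRep R T) (n + Module.finrank ℤ_[p] T) Φ')
    {c : Comp (quotRep (asRep R T) n)}
    {c' : Comp (quotRep (asRep R T) (n + Module.finrank ℤ_[p] T))}
    (h : IsLift c E φ) (h' : IsLift c' E (p • φ)) (x) :
    idPlusMu hR hT Φ Φ' ((compHom _ c).map 2 x) =
      (compHom _ c').map 2 (idPlusMu hR hT Φ Φ' x) := by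
  obtain ⟨⟨α, γ⟩, rfl⟩ := Φ.surjective x
  have hmu : ∀ α γ, idPlusMu hR hT Φ Φ' (Φ (α, γ)) = Φ' (α, mu hR hT n γ) := fun α γ => by
    change Φ' (((AddEquiv.refl _).prodCongr (mu hR hT n)) (Φ.symm (Φ (α, γ)))) = _
    rw [Φ.symm_apply_apply]
    rfl
  rw [h.map_apply hd hΦ, hmu, hmu, h'.map_apply hd' hΦ', map_add, mu_map_sub, mu_connecting,
    TwistedHom.map_map h.error (mulPQuot hR hT n) h'.error rfl (fun _ => rfl)]

end Step

end UniserialCohomology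

open UniserialCohomology in
theorem mainTheorem1 (p : ℕ) [Fact p.Prime] (R T : Type) [Group R] [Finite R] (hR : IsPGroup p R)
    [AddCommGroup T] [Module ℤ_[p] T] [Module.Free ℤ_[p] T] [Module.Finite ℤ_[p] T]
    [DistribMulAction R T] [SMulCommClass R ℤ_[p] T] (hT : IsUniserial p (asRep R T)) :
    ∃ N : ℕ, ∀ n ≥ N,
      (∃! Φ : groupCohomology (asRep R T) 2 × groupCohomology (subRep (asRep R T) n) 3 ≃+
          groupCohomology (quotRep (asRep R T) n) 2, IsCanonical (asRep R T) n Φ) ∧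
      ∀ Φ Φ', IsCanonical (asRep R T) n Φ →
        IsCanonical (asRep R T) (n + Module.finrank ℤ_[p] T) Φ' →
        ∃ e : Orbits (quotRep (asRep R T) n) ≃
            Orbits (quotRep (asRep R T) (n + Module.finrank ℤ_[p] T)),
          ∀ x : groupCohomology (quotRep (asRep R T) n) 2,
            e (Quotient.mk'' x) = Quotient.mk'' (idPlusMu hR hT Φ Φ' x) := by
  obtain ⟨N, hN⟩ := eventually_exists_eq hR hT
  refine ⟨N, fun n hn => ?_⟩
  have hs := hN n hn
  have hs' := hN (n + Module.finrank ℤ_[p] T) (hn.trans (Nat.le_add_right _ _))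
  have hd := isDeep_of_exists_eq hR hs
  have hd' := isDeep_of_exists_eq hR hs'
  refine ⟨hd.existsUnique_isCanonical, fun Φ Φ' hΦ hΦ' =>
    exists_orbits_equiv (idPlusMu hR hT Φ Φ') (fun c => ?_) fun c' => ?_⟩
  · obtain ⟨e, he⟩ := exists_lift p hT n c.1.2.toLinearMap.toAddMonoidHom
    obtain ⟨E, φ, h⟩ := exists_isLift hd c e.toIntLinearMap he
    obtain ⟨c', h'⟩ := exists_comp_isLift_of_surjective_mod hT hd' hs' (φ := p • φ)
      (h.exists_eq_add_nsmul hs)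
      (fun v => by
        change Nat.card R • p • φ v ∈ _
        rw [smul_comm]
        exact (nsmul_mem_lowerSeries_add_finrank hR hT).2 (h.nsmul_mem v))
      (fun g v => by
        change p • φ (g • v) - c.1.1 g • p • φ v ∈ _
        rw [smul_comm (c.1.1 g), ← smul_sub]
        exact (nsmul_mem_lowerSeries_add_finrank hR hT).2 (h.comm g v))
    exact ⟨c', idPlusMu_map hR hT hd hd' hΦ hΦ' h h'⟩
  · obtain ⟨e, he⟩ := exists_lift p hT _ c'.1.2.toLinearMap.toAddMonoidHom
    -- `ψ` has values in `|R|⁻¹ T_{n+d}`, hence in `p T`.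
    obtain ⟨E, ψ, h'⟩ := exists_isLift hd' c' e.toIntLinearMap he
    obtain ⟨φ, hφ⟩ := exists_nsmul_eq (nsmul_injective p T) ψ fun v =>
      (hs' _ (h'.nsmul_mem v)).imp' _ fun _ h => h
    obtain rfl : ψ = p • φ := LinearMap.ext hφ
    obtain ⟨c, h⟩ := exists_comp_isLift_of_surjective_mod hT hd hs (φ := φ)
      (h'.exists_eq_add_nsmul hs')
      (fun v => (nsmul_mem_lowerSeries_add_finrank hR hT).1 (by
        rw [smul_comm]
        exact h'.nsmul_mem v))
      (fun g v => (nsmul_mem_lowerSeries_add_finrank hR hT).1 (by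
        rw [smul_sub, ← smul_comm (c'.1.1 g)]
        exact h'.comm g v))
    exact ⟨c, idPlusMu_map hR hT hd hd' hΦ hΦ' h h'⟩
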